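/- Let $N\ge 2$ and let $M$ be an $N\times N$ complex Ginibre matrix, i.e. its entries are i.i.d. complex Gaussian variables with mean $0$ and variance $1/N$. Here $\mathcal N_{\mathbb C}(\mu,v)$ denotes the law of $X+iY$ with $X,Y$ independent real Gaussian variables of means $\operatorname{Re}\mu,\operatorname{Im}\mu$ and variance $v/2$ each. Let $z\in\mathbb C$. Almost surely, $z$ is not in the spectrum of $M$ and $[(z\mathbf 1-M)^{-1}]_{11}\neq 0$. The function $$ f(t)=\frac{e^{-\frac{N|z|^2}{1+1/t}}}{(N-2)!}\,\frac{t^{N-2}}{(1+t)^N}\left(\Gamma(N-1,N|z|^2)\,e^{N|z|^2}\Big(N-1-\frac{tN}{1+t}|z|^2\Big)+\big(N|z|^2\big)^{N-1}\right),\qquad t>0, $$ where $\Gamma(s,x)=\int_x^{+\infty}u^{s-1}e^{-u}\,du$, is non-negative and is the probability density function of a random variable $t>0$, defined on the same probability space as $M$, such that, conditionally on $t$, $$ \frac{1}{[(z\mathbf 1-M)^{-1}]_{11}}-z\ \sim\ \mathcal N_{\mathbb C}\Big(0,\frac{1+t}{N}\Big). $$ In particular, the law of $1/[(z\mathbf 1-M)^{-1}]_{11}-z$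 is the mixture of the Gaussian laws $\mathcal N_{\mathbb C}(0,\frac{1+t}{N})$ over $t$ with density $f$. -/

import Mathlib

open MeasureTheory ProbabilityTheory
open scoped NNReal ENNReal

/-- The complex Gaussian law `N_ℂ(μ, v)` with mean `μ` and variance `v`: the law of `X + i Y` with
`X`, `Y` independent real Gaussian variables of means `re μ`, `im μ` and variance `v / 2` each.
For `v > 0` its density is `z ↦ exp (-|z - μ|² / v) / (π v)`. -/
noncomputable def complexGaussian (μ : ℂ) (v : ℝ≥0) : Measure ℂ :=
  ((gaussianReal μ.re (v / 2)).prod (gaussianReal μ.im (v / 2))).map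
    Complex.measurableEquivRealProd.symm

instance (μ : ℂ) (v : ℝ≥0) : IsProbabilityMeasure (complexGaussian μ v) :=
  Measure.isProbabilityMeasure_map (MeasurableEquiv.measurable _).aemeasurable

theorem measurable_complexGaussian :
    Measurable (fun p : ℂ × ℝ≥0 => complexGaussian p.1 p.2) := by
  let κ₁ : Kernel (ℂ × ℝ≥0) ℝ :=
    ⟨fun p => gaussianReal p.1.re (p.2 / 2), measurable_gaussianReal.comp
      (f := fun p : ℂ × ℝ≥0 => (p.1.re, p.2 / 2)) (by fun_prop)⟩
  let κ₂ : Kernel (ℂ × ℝ≥0) ℝ :=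
    ⟨fun p => gaussianReal p.1.im (p.2 / 2), measurable_gaussianReal.comp
      (f := fun p : ℂ × ℝ≥0 => (p.1.im, p.2 / 2)) (by fun_prop)⟩
  have h₁ : IsMarkovKernel κ₁ := ⟨fun p => by
    change IsProbabilityMeasure (gaussianReal _ _); infer_instance⟩
  have h₂ : IsMarkovKernel κ₂ := ⟨fun p => by
    change IsProbabilityMeasure (gaussianReal _ _); infer_instance⟩
  have h : (fun p : ℂ × ℝ≥0 => complexGaussian p.1 p.2)
      = fun p => ((κ₁ ×ₖ κ₂) p).map Complex.measurableEquivRealProd.symm := by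
    funext p
    rw [Kernel.prod_apply]
    rfl
  rw [h]
  exact (Measure.measurable_map _ (MeasurableEquiv.measurable _)).comp (κ₁ ×ₖ κ₂).measurable

/-- `M` is an `N × N` complex Ginibre matrix under `P`: its entries are i.i.d. complex Gaussian
variables with mean `0` and variance `1 / N`. -/
structure IsComplexGinibre {Ω : Type*} [MeasurableSpace Ω] {N : ℕ}
    (M : Ω → Matrix (Fin N) (Fin N) ℂ) (P : Measure Ω) : Prop where
  hasLaw : ∀ i j, HasLaw (fun ω => M ω i j) (complexGaussian 0 (1 / (N : ℝ≥0))) P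
  iIndepFun : iIndepFun (fun (p : Fin N × Fin N) (ω : Ω) => M ω p.1 p.2) P

/-- The upper incomplete Gamma function `Γ(s, x) = ∫_x^∞ u^(s-1) e^(-u) du`. -/
noncomputable def upperIncompleteGamma (s x : ℝ) : ℝ :=
  ∫ u in Set.Ioi x, u ^ (s - 1) * Real.exp (-u)

/-- The density on `(0, ∞)` of the mixing variable `t`. -/
noncomputable def mixingDensity (N : ℕ) (z : ℂ) (t : ℝ) : ℝ :=
  Real.exp (-(N * ‖z‖ ^ 2 / (1 + 1 / t))) / ((N - 2).factorial : ℝ)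
    * (t ^ (N - 2) / (1 + t) ^ N)
    * (upperIncompleteGamma ((N : ℝ) - 1) (N * ‖z‖ ^ 2) * Real.exp (N * ‖z‖ ^ 2)
        * ((N : ℝ) - 1 - t * N / (1 + t) * ‖z‖ ^ 2)
      + (N * ‖z‖ ^ 2) ^ (N - 1))

/-- The measure on `ℝ` carried by `(0, ∞)`, with Lebesgue density `mixingDensity N z` there. -/
noncomputable def mixingLaw (N : ℕ) (z : ℂ) : Measure ℝ :=
  (volume.restrict (Set.Ioi 0)).withDensity fun t => ENNReal.ofReal (mixingDensity N z t)

/-- The family of laws `s ↦ N_ℂ(0, (1 + s) / N)`, as a kernel. -/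
noncomputable def varianceKernel (N : ℕ) : Kernel ℝ ℂ where
  toFun s := complexGaussian 0 (Real.toNNReal ((1 + s) / N))
  measurable' := measurable_complexGaussian.comp
    (f := fun s : ℝ => ((0 : ℂ), Real.toNNReal ((1 + s) / N))) (by fun_prop)

instance (N : ℕ) : IsMarkovKernel (varianceKernel N) :=
  ⟨fun s => inferInstanceAs
    (IsProbabilityMeasure (complexGaussian 0 (Real.toNNReal ((1 + s) / N))))⟩

/-- The entry `[(z 1 - A)⁻¹]₁₁` of the resolvent of an `N × N` matrix `A` (indices start at `0`). -/
noncomputable def resolvent11 {N : ℕ} [NeZero N] (A : Matrix (Fin N) (Fin N) ℂ) (z : ℂ) : ℂ :=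
  (z • (1 : Matrix (Fin N) (Fin N) ℂ) - A)⁻¹ 0 0

/-! Split `M` into its first row, the rest `c` of its first column, and the remaining block `M'`,
and put w = (z - M')⁻¹c. By the Schur complement, 1/[(z - M)⁻¹]₁₁ - z is minus the pairing of the
first row with (1, w). The first row is Gaussian and independent of (c, M'), so given (c, M') this
is a centred complex Gaussian of variance (1 + ‖w‖²)/N. Hence t = ‖w‖² is the mixing variable
(`map_schurPair_gaussianPi`), and what remains is its law, in dimension N - 1 with entries still of
variance 1/N.

That law is found by recursion on the dimension (`lintegral_resolventNormSqLaw_succ`). Unitary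
invariance of the matrix replaces c by ‖c‖e₁, so in law t is the product of the independent
variables ‖c‖², which is Gamma, and ‖(z - M')⁻¹e₁‖². A second Schur complement writes the latter as
(1 + s)/|z + y|², where s is the same quantity one dimension lower and y given s is complex Gaussian
of variance (1 + s)/N.

Normalised by its variance, |z + y|² is a Poisson mixture of Gamma variables
(`map_norm_sq_complexGaussian`). The density of t given s is therefore a series in k whose terms are
each a function of s times a function of t. So, with a = N|z|², the previous law enters only through
the moments E[exp(-a/(1+s)) (1+s)⁻ᵏ].

The recursion closes on explicit formulas: the moments `resolventMoment` in dimension m sum to the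
density `resolventDensity` in dimension m + 1 (`hasSum_resolventDensity`), and Beta integrals of
that density give back the moments in dimension m + 1 (`lintegral_resolventDensity`). -/

/-! ### Characteristic functions of complex Gaussian laws -/

theorem integral_complexGaussian_mul (v : ℝ≥0) (f g : ℝ → ℂ) :
    ∫ y, f y.re * g y.im ∂(complexGaussian 0 v)
      = (∫ x, f x ∂(gaussianReal 0 (v / 2))) * ∫ x, g x ∂(gaussianReal 0 (v / 2)) := by
  rw [complexGaussian, integral_map_equiv, ← integral_prod_mul]
  rfl

/-- A Gaussian integral with complex quadratic coefficient. The square root is left as a principal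
power: only the product of two such factors, from the real and imaginary parts, is needed later. -/
theorem integral_cexp_sq_gaussianReal (w : ℝ≥0) (hw : w ≠ 0) (b ξ : ℝ) :
    ∫ x, Complex.exp (((ξ * (b + x) ^ 2 : ℝ) : ℂ) * Complex.I) ∂(gaussianReal 0 w)
      = (((√(2 * Real.pi * w))⁻¹ : ℝ) : ℂ)
          * (Real.pi / (1 / (2 * w) - ξ * Complex.I)) ^ (1 / 2 : ℂ)
        * Complex.exp (ξ * b ^ 2 * Complex.I / (1 - 2 * w * ξ * Complex.I)) := by
  have hw' : (0 : ℝ) < w := by positivity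
  have hwc : (w : ℂ) ≠ 0 := by exact_mod_cast hw'.ne'
  have hne : (1 - 2 * w * ξ * Complex.I : ℂ) ≠ 0 := fun h => by
    have := congrArg Complex.re h
    simp at this
  rw [integral_gaussianReal_eq_integral_smul hw]
  have h := integral_cexp_quadratic (b := -(1 / (2 * w)) + ξ * Complex.I)
    (by simp [← Complex.ofReal_ofNat, ← Complex.ofReal_mul, -Complex.ofReal_inv, -mul_inv_rev]; positivity)
    (2 * ξ * b * Complex.I) (ξ * b ^ 2 * Complex.I)
  have e : ∀ x : ℝ, gaussianPDFReal 0 w x • Complex.exp (((ξ * (b + x) ^ 2 : ℝ) : ℂ) * Complex.I)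
      = (((√(2 * Real.pi * w))⁻¹ : ℝ) : ℂ) * Complex.exp ((-(1 / (2 * w)) + ξ * Complex.I) * x ^ 2
          + (2 * ξ * b * Complex.I) * x + ξ * b ^ 2 * Complex.I) := by
    intro x
    rw [gaussianPDFReal, Complex.real_smul, Complex.ofReal_mul, mul_assoc, Complex.ofReal_exp,
      ← Complex.exp_add]
    congr 2
    push_cast
    field_simp
    ring
  simp_rw [e]
  rw [integral_const_mul, h, ← mul_assoc]
  congr 1
  · congr 3; ring
  · congr 1
    have h2 : (-1 + ξ * (2 * w) * Complex.I : ℂ) ≠ 0 := by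
      intro h; apply hne; linear_combination -h
    have h3 : (-(1 / (2 * w)) + ξ * Complex.I : ℂ) = (-1 + ξ * (2 * w) * Complex.I) / (2 * w) := by
      field_simp
    have h4 : (1 - 2 * w * ξ * Complex.I : ℂ) = -(-1 + ξ * (2 * w) * Complex.I) := by ring
    rw [h3, h4]
    generalize hD : (-1 + ξ * (2 * w) * Complex.I : ℂ) = D at h2
    field_simp
    linear_combination (-4 * ξ * b ^ 2 : ℂ) * hD

/-- Characteristic function of a noncentral squared modulus. The case b = 0 yields Gamma laws for
norms of Gaussian vectors, the general case the Poisson mixture. -/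
theorem integral_cexp_normSq_complexGaussian (v : ℝ≥0) (hv : v ≠ 0) (b : ℂ) (ξ : ℝ) :
    ∫ y, Complex.exp (((ξ * ‖b + y‖ ^ 2 : ℝ) : ℂ) * Complex.I) ∂(complexGaussian 0 v)
      = (1 - v * ξ * Complex.I)⁻¹
        * Complex.exp (ξ * (‖b‖ ^ 2 : ℝ) * Complex.I / (1 - v * ξ * Complex.I)) := by
  have hv' : (0 : ℝ) < v := by positivity
  have hvc : (v : ℂ) ≠ 0 := by exact_mod_cast hv'.ne'
  have hne : (1 - v * ξ * Complex.I : ℂ) ≠ 0 := fun h => by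
    have := congrArg Complex.re h
    simp at this
  have e : ∀ y : ℂ, Complex.exp (((ξ * ‖b + y‖ ^ 2 : ℝ) : ℂ) * Complex.I)
      = Complex.exp (((ξ * (b.re + y.re) ^ 2 : ℝ) : ℂ) * Complex.I)
        * Complex.exp (((ξ * (b.im + y.im) ^ 2 : ℝ) : ℂ) * Complex.I) := by
    intro y
    rw [← Complex.exp_add, ← Complex.normSq_eq_norm_sq, Complex.normSq_apply]
    congr 1
    push_cast [Complex.add_re, Complex.add_im]
    ring
  simp_rw [e]
  rw [integral_complexGaussian_mul v
    (fun x => Complex.exp (((ξ * (b.re + x) ^ 2 : ℝ) : ℂ) * Complex.I))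
    (fun x => Complex.exp (((ξ * (b.im + x) ^ 2 : ℝ) : ℂ) * Complex.I)),
    integral_cexp_sq_gaussianReal _ (by positivity), integral_cexp_sq_gaussianReal _ (by positivity)]
  have h2 : (2 * ((v / 2 : ℝ≥0) : ℂ)) = v := by push_cast; ring
  have h2' : (2 * Real.pi * ((v / 2 : ℝ≥0) : ℝ)) = Real.pi * v := by push_cast; ring
  simp only [h2, h2']
  have h5 : (((√(Real.pi * v))⁻¹ : ℝ) : ℂ) * (((√(Real.pi * v))⁻¹ : ℝ) : ℂ) = (Real.pi * v)⁻¹ := by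
    rw [← Complex.ofReal_mul, ← mul_inv, Real.mul_self_sqrt (by positivity)]
  -- The two equal half-powers recombine whatever the branch, so no argument has to be tracked.
  have h6 : ∀ x : ℂ, x ^ (1 / 2 : ℂ) * x ^ (1 / 2 : ℂ) = x := by
    intro x
    rw [← sq, one_div]
    exact Complex.cpow_nat_inv_pow x two_ne_zero
  calc _ = ((((√(Real.pi * v))⁻¹ : ℝ) : ℂ) * (((√(Real.pi * v))⁻¹ : ℝ) : ℂ))
        * ((Real.pi / (1 / v - ξ * Complex.I)) ^ (1 / 2 : ℂ)
          * (Real.pi / (1 / v - ξ * Complex.I)) ^ (1 / 2 : ℂ))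
        * (Complex.exp (ξ * b.re ^ 2 * Complex.I / (1 - v * ξ * Complex.I))
          * Complex.exp (ξ * b.im ^ 2 * Complex.I / (1 - v * ξ * Complex.I))) := by ring
    _ = _ := by
      rw [h5, h6, ← Complex.exp_add, ← add_div]
      congr 1
      · have h7 : (1 / v - ξ * Complex.I : ℂ) = (1 - v * ξ * Complex.I) / v := by
          field_simp
        rw [h7]
        have : (Real.pi : ℂ) ≠ 0 := by exact_mod_cast Real.pi_ne_zero
        push_cast
        field_simp
      · rw [← Complex.normSq_eq_norm_sq, Complex.normSq_apply]
        congr 2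
        push_cast
        ring

theorem integral_cexp_re_mul_complexGaussian (v : ℝ≥0) (η : ℂ) :
    ∫ y, Complex.exp (((η * y).re : ℂ) * Complex.I) ∂(complexGaussian 0 v)
      = Complex.exp (-(v * ‖η‖ ^ 2 / 4 : ℝ)) := by
  have e : ∀ y : ℂ, Complex.exp (((η * y).re : ℂ) * Complex.I)
      = Complex.exp ((η.re : ℂ) * y.re * Complex.I) * Complex.exp (((-η.im : ℝ) : ℂ) * y.im * Complex.I) := by
    intro y
    rw [← Complex.exp_add, Complex.mul_re]
    congr 1
    push_cast
    ring
  simp_rw [e]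
  rw [integral_complexGaussian_mul v (fun x => Complex.exp ((η.re : ℂ) * x * Complex.I))
    (fun x => Complex.exp (((-η.im : ℝ) : ℂ) * x * Complex.I)),
    ← charFun_apply_real, ← charFun_apply_real, charFun_gaussianReal, charFun_gaussianReal,
    ← Complex.exp_add, ← Complex.normSq_eq_norm_sq, Complex.normSq_apply]
  congr 1
  push_cast
  ring

/-- A complex Gaussian law is characterised by the integrals of the characters `y ↦ e^{i Re (η y)}`. -/
theorem eq_complexGaussian_of_integral_cexp {μ : Measure ℂ} [IsFiniteMeasure μ] {v : ℝ≥0}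
    (h : ∀ η : ℂ, ∫ y, Complex.exp (((η * y).re : ℂ) * Complex.I) ∂μ
      = Complex.exp (-(v * ‖η‖ ^ 2 / 4 : ℝ))) :
    μ = complexGaussian 0 v := by
  refine Measure.ext_of_charFun (funext fun ξ => ?_)
  have e : ∀ y : ℂ, (inner ℝ y ξ : ℝ) = (ξ * (starRingEnd ℂ) y).re := fun y => Complex.inner y ξ ▸ rfl
  have e' : ∀ y : ℂ, (inner ℝ y ξ : ℝ) = ((starRingEnd ℂ) ξ * y).re := fun y => by
    rw [e, Complex.mul_re, Complex.mul_re]; simp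
  simp_rw [charFun_apply, e']
  rw [h, integral_cexp_re_mul_complexGaussian]

/-- The real part alone has an atomless law and so almost surely differs from `z.re`. -/
theorem ae_complexGaussian_ne {v : ℝ≥0} (hv : v ≠ 0) (z : ℂ) :
    ∀ᵐ y ∂(complexGaussian 0 v), y ≠ z := by
  have hv2 : v / 2 ≠ 0 := by positivity
  have := nullSingletonClass_gaussianReal (μ := 0) hv2
  have hz : MeasurableSet {y : ℂ | y ≠ z} := (measurableSet_singleton z).compl
  rw [complexGaussian, ae_map_iff (by fun_prop) hz]
  have h : ∀ᵐ x ∂(gaussianReal 0 (v / 2)), x ≠ z.re := by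
    simp [ae_iff, measure_singleton]
  have h2 := Measure.quasiMeasurePreserving_fst (μ := gaussianReal (0:ℂ).re (v / 2))
    (ν := gaussianReal (0:ℂ).im (v / 2)) |>.ae h
  filter_upwards [h2] with p hp hpz
  exact hp (by rw [← hpz]; rfl)

/-! ### Schur complement of the first coordinate -/

open Matrix in
/-- The squared norm of `(z 1 - M)⁻¹ c`. -/
noncomputable def resolventNormSq {ι : Type*} [Fintype ι] [DecidableEq ι] (z : ℂ)
    (M : Matrix ι ι ℂ) (c : ι → ℂ) : ℝ :=
  ∑ i, ‖((z • (1 : Matrix ι ι ℂ) - M)⁻¹ *ᵥ c) i‖ ^ 2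

/-- The denominator in the Schur complement formula for `[(z 1 - M)⁻¹]₁₁`. -/
noncomputable def schurDenominator {n : ℕ} (z : ℂ) (M : Matrix (Fin (n + 1)) (Fin (n + 1)) ℂ) : ℂ :=
  z - M 0 0 - ∑ j : Fin n, M 0 j.succ * (((z • (1 : Matrix (Fin n) (Fin n) ℂ)
    - M.submatrix Fin.succ Fin.succ)⁻¹).mulVec fun i => M i.succ 0) j

section Schur

variable {n : ℕ} {z : ℂ} {M : Matrix (Fin (n + 1)) (Fin (n + 1)) ℂ}

open Matrix

/-- Block elimination: a kernel vector x of z - M must have tail x₀w, with w = (z - M')⁻¹c, and its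
first coordinate then satisfies x₀d = 0, where d is the Schur denominator. The same elimination
shows that z - M sends (1, w)/d to e₁. -/
theorem isUnit_of_schurDenominator_ne_zero
    (hM : IsUnit (z • (1 : Matrix (Fin n) (Fin n) ℂ) - M.submatrix Fin.succ Fin.succ))
    (hd : schurDenominator z M ≠ 0) :
    IsUnit (z • (1 : Matrix (Fin (n + 1)) (Fin (n + 1)) ℂ) - M) ∧
    (z • (1 : Matrix (Fin (n + 1)) (Fin (n + 1)) ℂ) - M)⁻¹ *ᵥ Pi.single 0 1
      = (schurDenominator z M)⁻¹ • Fin.cons 1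
        ((z • (1 : Matrix (Fin n) (Fin n) ℂ) - M.submatrix Fin.succ Fin.succ)⁻¹ *ᵥ
          fun i => M i.succ 0) := by
  set B := z • (1 : Matrix (Fin n) (Fin n) ℂ) - M.submatrix Fin.succ Fin.succ with hB
  set w := B⁻¹ *ᵥ fun i => M i.succ 0 with hw
  set A := z • (1 : Matrix (Fin (n + 1)) (Fin (n + 1)) ℂ) - M with hA
  have hBdet : IsUnit B.det := (Matrix.isUnit_iff_isUnit_det B).1 hM
  have hBw : B *ᵥ w = fun i => M i.succ 0 := by
    rw [hw, mulVec_mulVec, mul_nonsing_inv _ hBdet, one_mulVec]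
  have hd' : schurDenominator z M = z - M 0 0 - ∑ j : Fin n, M 0 j.succ * w j := rfl
  have hA0 : ∀ x : Fin (n + 1) → ℂ, (A *ᵥ x) 0
      = (z - M 0 0) * x 0 - ∑ j : Fin n, M 0 j.succ * x j.succ := by
    intro x
    rw [mulVec, dotProduct, Fin.sum_univ_succ]
    simp [hA, sub_eq_add_neg, (Fin.succ_ne_zero _).symm]
  have hAs : ∀ (x : Fin (n + 1) → ℂ) (i : Fin n), (A *ᵥ x) i.succ
      = (B *ᵥ fun j => x j.succ) i - M i.succ 0 * x 0 := by
    intro x i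
    rw [mulVec, dotProduct, Fin.sum_univ_succ]
    simp only [hA, hB, mulVec, dotProduct, Matrix.sub_apply, Matrix.smul_apply, Matrix.one_apply,
      Matrix.submatrix_apply, Fin.succ_inj, Fin.succ_ne_zero, if_false]
    simp
    ring
  have hunit : IsUnit A := by
    rw [← Matrix.mulVec_injective_iff_isUnit]
    refine (injective_iff_map_eq_zero (Matrix.mulVecLin A)).2 fun x hx => ?_
    rw [mulVecLin_apply] at hx
    have hs : (fun j : Fin n => x j.succ) = x 0 • w := by
      have h1 : B *ᵥ (fun j => x j.succ) = x 0 • fun i => M i.succ 0 := by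
        funext i
        have := hAs x i
        rw [hx, Pi.zero_apply, eq_comm, sub_eq_zero] at this
        rw [this, Pi.smul_apply, smul_eq_mul, mul_comm]
      rw [hw, ← mulVec_smul, ← h1, mulVec_mulVec, nonsing_inv_mul _ hBdet, one_mulVec]
    have hs' : ∀ j : Fin n, x j.succ = x 0 * w j := fun j => congrFun hs j
    have h0 : x 0 = 0 := by
      have := hA0 x
      rw [hx, Pi.zero_apply] at this
      simp_rw [hs'] at this
      have h2 : x 0 * schurDenominator z M = 0 := by
        rw [hd', mul_sub, Finset.mul_sum, this]
        congr 1
        · ring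
        · exact Finset.sum_congr rfl fun j _ => by ring
      exact (mul_eq_zero.1 h2).resolve_right hd
    funext i
    refine Fin.cases h0 (fun j => ?_) i
    rw [hs' j, h0, zero_mul, Pi.zero_apply]
  refine ⟨hunit, ?_⟩
  have hAdet : IsUnit A.det := (Matrix.isUnit_iff_isUnit_det A).1 hunit
  have key : A *ᵥ ((schurDenominator z M)⁻¹ • Fin.cons 1 w) = Pi.single 0 1 := by
    rw [mulVec_smul]
    funext i
    refine Fin.cases ?_ (fun j => ?_) i
    · rw [Pi.smul_apply, hA0]
      simp only [Fin.cons_zero, Fin.cons_succ, mul_one, ← hd', smul_eq_mul, Pi.single_eq_same]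
      exact inv_mul_cancel₀ hd
    · rw [Pi.smul_apply, hAs]
      simp [hBw]
  rw [← key, mulVec_mulVec, nonsing_inv_mul _ hAdet, one_mulVec]

theorem resolvent11_eq_inv_schurDenominator
    (hM : IsUnit (z • (1 : Matrix (Fin n) (Fin n) ℂ) - M.submatrix Fin.succ Fin.succ))
    (hd : schurDenominator z M ≠ 0) :
    resolvent11 M z = (schurDenominator z M)⁻¹ := by
  have := congrFun (isUnit_of_schurDenominator_ne_zero hM hd).2 0
  rw [mulVec_single_one] at this
  simpa [resolvent11] using this

/-- Squared norm of the column (1, w)/d. This links dimension n + 1 to dimension n and drives the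
recursion on the law. -/
theorem resolventNormSq_single
    (hM : IsUnit (z • (1 : Matrix (Fin n) (Fin n) ℂ) - M.submatrix Fin.succ Fin.succ))
    (hd : schurDenominator z M ≠ 0) :
    resolventNormSq z M (Pi.single 0 1)
      = (1 + resolventNormSq z (M.submatrix Fin.succ Fin.succ) fun i => M i.succ 0)
        / ‖schurDenominator z M‖ ^ 2 := by
  rw [resolventNormSq, (isUnit_of_schurDenominator_ne_zero hM hd).2, Fin.sum_univ_succ]
  simp only [Pi.smul_apply, smul_eq_mul, norm_mul, mul_pow, Fin.cons_zero, Fin.cons_succ, norm_inv,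
    ← Finset.mul_sum, norm_one, resolventNormSq]
  field_simp

end Schur

/-! ### Unitary covariance of the resolvent norm -/

section Unitary

open Matrix

variable {ι : Type*} [Fintype ι] [DecidableEq ι]

theorem sum_norm_sq_mulVec_of_mem_unitary {U : Matrix ι ι ℂ} (hU : U ∈ unitary (Matrix ι ι ℂ))
    (x : ι → ℂ) : ∑ i, ‖(U *ᵥ x) i‖ ^ 2 = ∑ i, ‖x i‖ ^ 2 := by
  have h : ∀ y : ι → ℂ, ((∑ i, ‖y i‖ ^ 2 : ℝ) : ℂ) = star y ⬝ᵥ y := by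
    intro y
    rw [dotProduct, Complex.ofReal_sum]
    refine Finset.sum_congr rfl fun i _ => ?_
    rw [Pi.star_apply, ← Complex.normSq_eq_norm_sq, Complex.normSq_eq_conj_mul_self]
    rfl
  rw [← Complex.ofReal_inj, h, h, star_mulVec, dotProduct_mulVec, vecMul_vecMul,
    ← star_eq_conjTranspose, (Unitary.mem_iff.1 hU).1, vecMul_one]

theorem resolventNormSq_unitary {U : Matrix ι ι ℂ} (hU : U ∈ unitary (Matrix ι ι ℂ)) (z : ℂ)
    (M : Matrix ι ι ℂ) (c : ι → ℂ) :
    resolventNormSq z M (U *ᵥ c) = resolventNormSq z (star U * M * U) c := by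
  have h1 := (Unitary.mem_iff.1 hU).1
  have h2 := (Unitary.mem_iff.1 hU).2
  have hinv : U⁻¹ = star U := inv_eq_right_inv h2
  have hinv' : (star U)⁻¹ = U := inv_eq_right_inv h1
  have e : z • (1 : Matrix ι ι ℂ) - star U * M * U = star U * (z • (1 : Matrix ι ι ℂ) - M) * U := by
    rw [Matrix.mul_sub, Matrix.sub_mul, Matrix.mul_smul, Matrix.smul_mul, Matrix.mul_one, h1]
  rw [resolventNormSq, resolventNormSq, e, Matrix.mul_inv_rev, Matrix.mul_inv_rev, hinv, hinv',
    ← mulVec_mulVec, sum_norm_sq_mulVec_of_mem_unitary (Unitary.star_mem hU), mulVec_mulVec]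

theorem resolventNormSq_smul (z : ℂ) (M : Matrix ι ι ℂ) (r : ℂ) (c : ι → ℂ) :
    resolventNormSq z M (r • c) = ‖r‖ ^ 2 * resolventNormSq z M c := by
  simp [resolventNormSq, mulVec_smul, mul_pow, Finset.mul_sum]

theorem exists_unitary_mulVec_single (i : ι) (c : ι → ℂ) (hc : ∑ j, ‖c j‖ ^ 2 = 1) :
    ∃ U ∈ unitary (Matrix ι ι ℂ), U *ᵥ Pi.single i 1 = c := by
  have hn : ‖(WithLp.toLp 2 c : EuclideanSpace ℂ ι)‖ = 1 := by
    rw [EuclideanSpace.norm_eq]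
    simp [hc]
  -- The family is constant equal to c, but orthonormality is asked only on {i}. The extension is
  -- thus a basis whose i-th vector is c.
  obtain ⟨b, hb⟩ := Orthonormal.exists_orthonormalBasis_extension_of_card_eq (𝕜 := ℂ)
    (E := EuclideanSpace ℂ ι) (ι := ι) (by simp)
    (v := fun _ => (WithLp.toLp 2 c : EuclideanSpace ℂ ι)) (s := {i}) (by
      rw [orthonormal_iff_ite]
      rintro ⟨a, rfl⟩ ⟨b, hb⟩
      obtain rfl : b = a := hb
      simp [Set.domRestrict, inner_self_eq_norm_sq_to_K, hn])
  refine ⟨_, (EuclideanSpace.basisFun ι ℂ).toMatrix_orthonormalBasis_mem_unitary b, ?_⟩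
  rw [mulVec_single_one]
  funext j
  have := hb i rfl
  simp [Module.Basis.toMatrix_apply, this]

end Unitary

/-! ### Gaussian vectors and matrices: linear images, unitary invariance, block splitting -/

/-- The law of a family of independent complex Gaussian variables with mean `0` and variance `v`. -/
noncomputable def gaussianPi (ι : Type*) [Fintype ι] (v : ℝ≥0) : Measure (ι → ℂ) :=
  Measure.pi fun _ => complexGaussian 0 v

instance (ι : Type*) [Fintype ι] (v : ℝ≥0) : IsProbabilityMeasure (gaussianPi ι v) :=
  inferInstanceAs (IsProbabilityMeasure (Measure.pi _))

section GaussianPi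

open Matrix

variable {ι κ α : Type*} [Fintype ι] [Fintype κ] [Fintype α]

theorem integral_cexp_re_dotProduct_gaussianPi (v : ℝ≥0) (η : ι → ℂ) :
    ∫ x, Complex.exp (((η ⬝ᵥ x).re : ℂ) * Complex.I) ∂(gaussianPi ι v)
      = Complex.exp (-(v * ∑ i, ‖η i‖ ^ 2) / 4 : ℝ) := by
  have e : ∀ x : ι → ℂ, Complex.exp (((η ⬝ᵥ x).re : ℂ) * Complex.I)
      = ∏ i, Complex.exp (((η i * x i).re : ℂ) * Complex.I) := by
    intro x
    rw [← Complex.exp_sum, dotProduct, Complex.re_sum, Complex.ofReal_sum, Finset.sum_mul]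
  simp_rw [e]
  rw [gaussianPi, integral_fintype_prod_eq_prod
    (fun i y => Complex.exp (((η i * y).re : ℂ) * Complex.I))]
  simp_rw [integral_cexp_re_mul_complexGaussian, ← Complex.ofReal_neg, ← Complex.ofReal_exp,
    ← Complex.ofReal_prod,
    ← Real.exp_sum]
  rw [Finset.sum_neg_distrib, neg_div, Finset.mul_sum, Finset.sum_div]

theorem map_dotProduct_gaussianPi (v : ℝ≥0) (η : ι → ℂ) :
    (gaussianPi ι v).map (fun x => η ⬝ᵥ x) = complexGaussian 0 (v * ∑ i, ‖η i‖₊ ^ 2) := by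
  have hm : Measurable fun x : ι → ℂ => η ⬝ᵥ x := by unfold dotProduct; fun_prop
  have := Measure.isProbabilityMeasure_map (μ := gaussianPi ι v) hm.aemeasurable
  refine eq_complexGaussian_of_integral_cexp fun ξ => ?_
  rw [integral_map hm.aemeasurable (by fun_prop)]
  have e : ∀ x : ι → ℂ, ξ * (η ⬝ᵥ x) = (ξ • η) ⬝ᵥ x := fun x => by
    rw [smul_dotProduct, smul_eq_mul]
  simp_rw [e]
  rw [integral_cexp_re_dotProduct_gaussianPi]
  congr 2
  simp [mul_pow, ← Finset.mul_sum]
  ring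

/-- The characteristic function at η depends only on ∑ ‖η i‖², which a unitary change of η
preserves. -/
theorem map_mulVec_gaussianPi [DecidableEq ι] (v : ℝ≥0) {U : Matrix ι ι ℂ}
    (hU : U ∈ unitary (Matrix ι ι ℂ)) :
    (gaussianPi ι v).map (fun x => U *ᵥ x) = gaussianPi ι v := by
  have hm : Measurable fun x : ι → ℂ => U *ᵥ x := by
    refine measurable_pi_lambda _ fun i => ?_
    unfold mulVec dotProduct
    fun_prop
  have := Measure.isProbabilityMeasure_map (μ := gaussianPi ι v) hm.aemeasurable
  refine Measure.ext_of_charFunDual (funext fun L => ?_)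
  -- L is only real-linear, so η is read off from its values at both 1 and i in each coordinate.
  obtain ⟨η, hη⟩ : ∃ η : ι → ℂ, ∀ x, L x = (η ⬝ᵥ x).re := by
    refine ⟨fun i => ⟨L (Pi.single i 1), -L (Pi.single i Complex.I)⟩, fun x => ?_⟩
    have hx : x = ∑ i, ((x i).re • (Pi.single i 1 : ι → ℂ)
        + (x i).im • (Pi.single i Complex.I : ι → ℂ)) := by
      funext j
      rw [Finset.sum_apply, Finset.sum_eq_single j]
      · simpa [mul_comm] using (Complex.re_add_im (x j)).symm
      · intro b _ hb
        simp [Pi.single_eq_of_ne hb.symm]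
      · simp
    conv_lhs => rw [hx]
    rw [map_sum, dotProduct, Complex.re_sum]
    refine Finset.sum_congr rfl fun i _ => ?_
    rw [map_add, map_smul, map_smul, Complex.mul_re, smul_eq_mul, smul_eq_mul]
    ring
  -- The dot product is bilinear, without conjugation, so moving U onto η produces Uᵀ and not the
  -- adjoint.
  have hUT : Uᵀ ∈ unitary (Matrix ι ι ℂ) := by
    rw [Unitary.mem_iff] at hU ⊢
    have e : star Uᵀ = (star U)ᵀ := by simp [star_eq_conjTranspose, conjTranspose]; rfl
    rw [e, ← transpose_mul, ← transpose_mul, hU.1, hU.2, transpose_one]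
    exact ⟨rfl, rfl⟩
  rw [charFunDual_apply, charFunDual_apply, integral_map hm.aemeasurable (by fun_prop)]
  simp_rw [hη, dotProduct_mulVec]
  rw [integral_cexp_re_dotProduct_gaussianPi, integral_cexp_re_dotProduct_gaussianPi,
    ← mulVec_transpose, sum_norm_sq_mulVec_of_mem_unitary hUT]

/-- On vectorised matrices, conjugation by U acts as the Kronecker product of U* and Uᵀ, which is
unitary, so the vector case applies. -/
theorem map_conj_gaussianPi [DecidableEq ι] (v : ℝ≥0) {U : Matrix ι ι ℂ}
    (hU : U ∈ unitary (Matrix ι ι ℂ)) :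
    (gaussianPi (ι × ι) v).map
      (fun x p => (star U * Matrix.of (Function.curry x) * U) p.1 p.2) = gaussianPi (ι × ι) v := by
  have hUT : Uᵀ ∈ unitary (Matrix ι ι ℂ) := by
    rw [Unitary.mem_iff] at hU ⊢
    have e : star Uᵀ = (star U)ᵀ := by simp [star_eq_conjTranspose, conjTranspose]; rfl
    rw [e, ← transpose_mul, ← transpose_mul, hU.1, hU.2, transpose_one]
    exact ⟨rfl, rfl⟩
  have e : (fun (x : ι × ι → ℂ) p => (star U * Matrix.of (Function.curry x) * U) p.1 p.2)
      = fun x => kroneckerMap (fun x1 x2 => x1 * x2) (star U) Uᵀ *ᵥ x := by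
    funext x p
    have h := congrFun (kronecker_mulVec_vec Uᵀ (Matrix.of (Function.curry x))ᵀ (star U)) p
    rw [← transpose_mul, ← transpose_mul, ← Matrix.mul_assoc] at h
    exact h.symm
  rw [e, map_mulVec_gaussianPi v (kronecker_mem_unitary (Unitary.star_mem hU) hUT)]

theorem measurePreserving_split_gaussianPi (v : ℝ≥0) (e : ι ⊕ κ ≃ α) :
    MeasurePreserving (fun x : α → ℂ => ((fun i => x (e (Sum.inl i))), fun j => x (e (Sum.inr j))))
      (gaussianPi α v) ((gaussianPi ι v).prod (gaussianPi κ v)) := by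
  have h1 := (measurePreserving_piCongrLeft (fun _ : α => complexGaussian 0 v) e).symm
  have h2 := measurePreserving_sumPiEquivProdPi (fun _ : ι ⊕ κ => complexGaussian 0 v)
  exact h2.comp h1

end GaussianPi

/-- The index splitting of a square matrix into first row, rest of the first column, and the
remaining block. -/
noncomputable def blockIndexEquiv (n : ℕ) :
    Fin (n + 1) ⊕ (Fin n ⊕ Fin n × Fin n) ≃ Fin (n + 1) × Fin (n + 1) :=
  Equiv.ofBijective
    (Sum.elim (fun j => (0, j)) (Sum.elim (fun i => (i.succ, 0)) fun p => (p.1.succ, p.2.succ)))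
    (by
      constructor
      · rintro (a | a | a) (b | b | b) h <;> simp_all [Prod.ext_iff, Fin.succ_ne_zero]
        all_goals first
          | exact Fin.succ_ne_zero _ h.1
          | exact Fin.succ_ne_zero _ h.1.symm
          | exact Fin.succ_ne_zero _ h.2.symm
      · rintro ⟨i, j⟩
        refine Fin.cases ⟨Sum.inl j, rfl⟩ (fun i => ?_) i
        refine Fin.cases ⟨Sum.inr (Sum.inl i), rfl⟩ (fun j => ?_) j
        exact ⟨Sum.inr (Sum.inr (i, j)), rfl⟩)

theorem measurePreserving_blocks_gaussianPi (n : ℕ) (v : ℝ≥0) :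
    MeasurePreserving (fun x : Fin (n + 1) × Fin (n + 1) → ℂ =>
        ((fun j => x (0, j)), ((fun i : Fin n => x (i.succ, 0)),
          fun p : Fin n × Fin n => x (p.1.succ, p.2.succ))))
      (gaussianPi (Fin (n + 1) × Fin (n + 1)) v)
      ((gaussianPi (Fin (n + 1)) v).prod
        ((gaussianPi (Fin n) v).prod (gaussianPi (Fin n × Fin n) v))) := by
  have h1 := measurePreserving_split_gaussianPi v (blockIndexEquiv n)
  have h2 := measurePreserving_split_gaussianPi v (Equiv.refl (Fin n ⊕ Fin n × Fin n))
  exact ((MeasurePreserving.id _).prod h2).comp h1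

/-! ### Gamma laws with integer shape -/

section GammaLaw

/-- Integration by parts in k. The rate is complex because the characteristic function of a Gamma
law of rate r uses s = r - iξ. -/
theorem integral_pow_mul_cexp_neg_mul_Ioi (k : ℕ) {s : ℂ} (hs : 0 < s.re) :
    ∫ x in Set.Ioi (0 : ℝ), (x : ℂ) ^ k * Complex.exp (-(s * x)) = k.factorial / s ^ (k + 1) := by
  have hs0 : s ≠ 0 := fun h => by simp [h] at hs
  have hnorm : ∀ (k : ℕ), ∀ x ∈ Set.Ioi (0 : ℝ), ‖(x : ℂ) ^ k * Complex.exp (-(s * x))‖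
      = x ^ k * Real.exp (-s.re * x) := by
    intro k x hx
    rw [norm_mul, norm_pow, Complex.norm_real, Real.norm_of_nonneg (le_of_lt hx), Complex.norm_exp]
    simp
  have hint : ∀ k : ℕ, IntegrableOn (fun x : ℝ => (x : ℂ) ^ k * Complex.exp (-(s * x)))
      (Set.Ioi 0) := by
    intro k
    have h := integrableOn_rpow_mul_exp_neg_mul_rpow (p := 1) (s := k) (b := s.re)
      (lt_of_lt_of_le (by norm_num) (Nat.cast_nonneg k)) one_pos hs
    refine Integrable.mono' h (Continuous.aestronglyMeasurable (by fun_prop)) ?_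
    filter_upwards [ae_restrict_mem measurableSet_Ioi] with x hx
    rw [hnorm k x hx, Real.rpow_one, Real.rpow_natCast]
  have hlim : ∀ k : ℕ, Filter.Tendsto (fun x : ℝ => (x : ℂ) ^ k * Complex.exp (-(s * x)))
      Filter.atTop (nhds 0) := by
    intro k
    rw [tendsto_zero_iff_norm_tendsto_zero]
    refine Filter.Tendsto.congr' ?_ (tendsto_rpow_mul_exp_neg_mul_atTop_nhds_zero k s.re hs)
    filter_upwards [Filter.eventually_gt_atTop 0] with x hx
    rw [hnorm k x hx, Real.rpow_natCast]
  induction k with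
  | zero =>
    have h := integral_Ioi_of_hasDerivAt_of_tendsto' (a := (0 : ℝ)) (m := 0)
      (f := fun x : ℝ => -(1 / s) * ((x : ℂ) ^ 0 * Complex.exp (-(s * x))))
      (f' := fun x : ℝ => (x : ℂ) ^ 0 * Complex.exp (-(s * x)))
      (fun x _ => by
        have h1 : HasDerivAt (fun x : ℝ => -(s * (x : ℂ))) (-(s * 1)) x :=
          ((Complex.ofRealCLM.hasDerivAt (x := x)).const_mul s).neg
        have h2 := (h1.cexp).const_mul (-(1 / s))
        simp only [pow_zero, one_mul]
        refine h2.congr_deriv ?_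
        field_simp)
      (hint 0) (by simpa using (hlim 0).const_mul (-(1 / s)))
    rw [h]
    simp
  | succ k ih =>
    have h := integral_Ioi_of_hasDerivAt_of_tendsto' (a := (0 : ℝ)) (m := 0)
      (f := fun x : ℝ => ((x : ℂ) ^ (k + 1) * Complex.exp (-(s * x))))
      (f' := fun x : ℝ => ((k + 1 : ℕ) : ℂ) * ((x : ℂ) ^ k * Complex.exp (-(s * x)))
        - s * ((x : ℂ) ^ (k + 1) * Complex.exp (-(s * x))))
      (fun x _ => by
        have h0 : HasDerivAt (fun x : ℝ => (x : ℂ)) 1 x := Complex.ofRealCLM.hasDerivAt (x := x)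
        have h1 := ((h0.const_mul s).neg.cexp)
        refine ((h0.pow (k + 1)).mul h1).congr_deriv ?_
        simp only [Nat.add_sub_cancel]
        simp
        ring)
      (((hint k).const_mul _).sub ((hint (k + 1)).const_mul _)) (hlim (k + 1))
    rw [integral_sub ((hint k).const_mul _) ((hint (k + 1)).const_mul _), integral_const_mul,
      integral_const_mul, ih] at h
    simp only [Complex.ofReal_zero, ne_eq, Nat.add_eq_zero_iff, one_ne_zero, and_false,
      not_false_eq_true, zero_pow, zero_mul, sub_zero, sub_eq_zero] at h
    rw [Nat.factorial_succ, eq_div_iff (by positivity), pow_succ, mul_comm (s ^ (k + 1)) s,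
      ← mul_assoc, mul_comm _ s, ← h]
    field_simp
    push_cast
    ring

theorem lintegral_gammaMeasure_nat (k : ℕ) (r : ℝ) {f : ℝ → ℝ≥0∞} (hf : Measurable f) :
    ∫⁻ x, f x ∂(gammaMeasure (k + 1) r) = ∫⁻ x in Set.Ioi 0,
      ENNReal.ofReal (r ^ (k + 1) / k.factorial * x ^ k * Real.exp (-(r * x))) * f x := by
  have hg : Measurable (gammaPDF (k + 1) r) := (measurable_gammaPDFReal _ _).ennreal_ofReal
  rw [gammaMeasure, lintegral_withDensity_eq_lintegral_mul _
    hg hf, ← lintegral_indicator measurableSet_Ioi]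
  have h0 : ∀ᵐ x : ℝ, x ≠ 0 := by simp [ae_iff]
  refine lintegral_congr_ae ?_
  filter_upwards [h0] with x hx
  rcases lt_or_gt_of_ne hx with h | h
  · rw [Set.indicator_of_notMem (by simpa using h.le), Pi.mul_apply, gammaPDF_of_neg h, zero_mul]
  · rw [Set.indicator_of_mem (by simpa using h), Pi.mul_apply, gammaPDF_of_nonneg h.le]
    congr 2
    rw [add_sub_cancel_right, Real.rpow_natCast, Real.Gamma_nat_eq_factorial]
    norm_cast

theorem integral_cexp_gammaMeasure_nat (k : ℕ) {r : ℝ} (hr : 0 < r) (ξ : ℝ) :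
    ∫ x, Complex.exp (((ξ * x : ℝ) : ℂ) * Complex.I) ∂(gammaMeasure (k + 1) r)
      = ((1 - ξ / r * Complex.I)⁻¹) ^ (k + 1) := by
  have hg : Measurable (gammaPDF (k + 1) r) := (measurable_gammaPDFReal _ _).ennreal_ofReal
  rw [gammaMeasure, integral_withDensity_eq_integral_toReal_smul
    hg (by simp [gammaPDF])]
  have h0 : ∀ᵐ x : ℝ, x ≠ 0 := by simp [ae_iff]
  have hre : 0 < ((r : ℂ) - ξ * Complex.I).re := by simpa using hr
  have hrc : (r : ℂ) ≠ 0 := by exact_mod_cast hr.ne'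
  have hne : ((r : ℂ) - ξ * Complex.I) ≠ 0 := fun h => by simp [h] at hre
  have e : (fun x : ℝ => (gammaPDF (k + 1) r x).toReal • Complex.exp (((ξ * x : ℝ) : ℂ) * Complex.I))
      =ᵐ[volume] (Set.Ioi 0).indicator fun x : ℝ => (r ^ (k + 1) / k.factorial : ℂ)
        * ((x : ℂ) ^ k * Complex.exp (-((r - ξ * Complex.I) * x))) := by
    filter_upwards [h0] with x hx
    rcases lt_or_gt_of_ne hx with h | h
    · rw [Set.indicator_of_notMem (by simpa using h.le), gammaPDF_of_neg h]
      simp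
    · rw [Set.indicator_of_mem (by simpa using h), gammaPDF_of_nonneg h.le,
        ENNReal.toReal_ofReal (by positivity), add_sub_cancel_right, Real.rpow_natCast,
        Real.Gamma_nat_eq_factorial, Complex.real_smul]
      have : (r ^ ((k : ℝ) + 1)) = r ^ (k + 1) := by norm_cast
      rw [this]
      push_cast
      rw [mul_assoc, mul_assoc, ← Complex.exp_add, ]
      congr 3
      ring_nf
  rw [integral_congr_ae e, integral_indicator measurableSet_Ioi, integral_const_mul,
    integral_pow_mul_cexp_neg_mul_Ioi k hre]
  have hk : (k.factorial : ℂ) ≠ 0 := by exact_mod_cast k.factorial_ne_zero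
  have h2 : (1 - ξ / r * Complex.I : ℂ) = (r - ξ * Complex.I) / r := by field_simp
  rw [h2, inv_div, div_pow]
  field_simp

/-- Both characteristic functions are (1 - ivξ)⁻¹ to the power n + 1, one factor per complex
coordinate. -/
theorem map_sum_norm_sq_gaussianPi (n : ℕ) {v : ℝ≥0} (hv : v ≠ 0) :
    (gaussianPi (Fin (n + 1)) v).map (fun x => ∑ i, ‖x i‖ ^ 2) = gammaMeasure (n + 1) (1 / v) := by
  have hv' : (0 : ℝ) < v := by positivity
  have hm : Measurable fun x : Fin (n + 1) → ℂ => ∑ i, ‖x i‖ ^ 2 := by fun_prop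
  have := Measure.isProbabilityMeasure_map (μ := gaussianPi (Fin (n + 1)) v) hm.aemeasurable
  have := isProbabilityMeasure_gammaMeasure (a := (n : ℝ) + 1) (r := 1 / v) (by positivity)
    (by positivity)
  refine Measure.ext_of_charFun (funext fun ξ => ?_)
  rw [charFun_apply_real, charFun_apply_real]
  simp_rw [← Complex.ofReal_mul]
  rw [integral_cexp_gammaMeasure_nat n (by positivity), integral_map hm.aemeasurable (by fun_prop)]
  have e : ∀ x : Fin (n + 1) → ℂ, Complex.exp (((ξ * ∑ i, ‖x i‖ ^ 2 : ℝ) : ℂ) * Complex.I)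
      = ∏ i, Complex.exp (((ξ * ‖0 + x i‖ ^ 2 : ℝ) : ℂ) * Complex.I) := by
    intro x
    rw [← Complex.exp_sum, ← Finset.sum_mul, ← Complex.ofReal_sum, Finset.mul_sum]
    simp
  simp_rw [e]
  rw [gaussianPi, integral_fintype_prod_eq_prod
    (fun _ y => Complex.exp (((ξ * ‖0 + y‖ ^ 2 : ℝ) : ℂ) * Complex.I))]
  simp_rw [integral_cexp_normSq_complexGaussian v hv]
  simp
  congr 3
  ring

end GammaLaw

/-! ### Measurability of the resolvent -/

section Measurability

open Matrix

variable {α ι : Type*} [MeasurableSpace α] [Fintype ι] [DecidableEq ι]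

theorem measurable_matrix_det {M : α → Matrix ι ι ℂ} (hM : ∀ i j, Measurable fun a => M a i j) :
    Measurable fun a => (M a).det := by
  simp_rw [det_apply]
  refine Finset.measurable_sum _ fun σ _ => ?_
  exact (Finset.measurable_prod _ fun i _ => hM _ _).const_smul _

/-- Adjugate divided by determinant. With 0⁻¹ = 0 this formula also covers singular matrices, so
measurability holds everywhere. -/
theorem measurable_matrix_inv {M : α → Matrix ι ι ℂ} (hM : ∀ i j, Measurable fun a => M a i j)
    (i j : ι) : Measurable fun a => (M a)⁻¹ i j := by
  simp_rw [inv_def, Ring.inverse_eq_inv', Matrix.smul_apply, smul_eq_mul, adjugate_apply]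
  refine (measurable_matrix_det hM).inv.mul (measurable_matrix_det fun k l => ?_)
  simp_rw [updateRow_apply]
  split_ifs
  · exact measurable_const
  · exact hM k l

theorem measurable_resolvent {M : α → Matrix ι ι ℂ} (hM : ∀ i j, Measurable fun a => M a i j)
    (z : ℂ) (i j : ι) : Measurable fun a => (z • (1 : Matrix ι ι ℂ) - M a)⁻¹ i j :=
  measurable_matrix_inv (fun k l => by
    simp_rw [Matrix.sub_apply]; exact (hM k l).const_sub _) i j

theorem measurable_resolvent_mulVec {M : α → Matrix ι ι ℂ}
    (hM : ∀ i j, Measurable fun a => M a i j) {c : α → ι → ℂ} (hc : ∀ i, Measurable fun a => c a i)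
    (z : ℂ) (i : ι) :
    Measurable fun a => ((z • (1 : Matrix ι ι ℂ) - M a)⁻¹ *ᵥ c a) i := by
  unfold mulVec dotProduct
  exact Finset.measurable_sum _ fun j _ => (measurable_resolvent hM z i j).mul (hc j)

theorem measurable_resolventNormSq {M : α → Matrix ι ι ℂ}
    (hM : ∀ i j, Measurable fun a => M a i j) {c : α → ι → ℂ} (hc : ∀ i, Measurable fun a => c a i)
    (z : ℂ) : Measurable fun a => resolventNormSq z (M a) (c a) := by
  unfold resolventNormSq
  exact Finset.measurable_sum _ fun i _ => (measurable_resolvent_mulVec hM hc z i).norm.pow_const 2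

end Measurability

/-! ### Joint law of the Schur data and the recursion on the dimension -/

/-- The law of `‖(z 1 - M)⁻¹ c‖²` for an `n × n` matrix `M` and a vector `c` with independent
complex Gaussian entries of variance `1 / N`. -/
noncomputable def resolventNormSqLaw (N : ℕ) (z : ℂ) (n : ℕ) : Measure ℝ :=
  ((gaussianPi (Fin n) (1 / (N : ℝ≥0))).prod (gaussianPi (Fin n × Fin n) (1 / (N : ℝ≥0)))).map
    fun p => resolventNormSq z (Matrix.of (Function.curry p.2)) p.1

theorem measurable_resolventNormSq_prod (z : ℂ) (n : ℕ) :
    Measurable fun p : (Fin n → ℂ) × (Fin n × Fin n → ℂ) =>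
      resolventNormSq z (Matrix.of (Function.curry p.2)) p.1 :=
  measurable_resolventNormSq (fun i j => by simp only [Matrix.of_apply, Function.curry]; fun_prop)
    (fun i => by fun_prop) z

instance (N : ℕ) (z : ℂ) (n : ℕ) : IsProbabilityMeasure (resolventNormSqLaw N z n) :=
  Measure.isProbabilityMeasure_map (measurable_resolventNormSq_prod z n).aemeasurable

theorem resolventNormSq_nonneg {ι : Type*} [Fintype ι] [DecidableEq ι] (z : ℂ)
    (M : Matrix ι ι ℂ) (c : ι → ℂ) : 0 ≤ resolventNormSq z M c :=
  Finset.sum_nonneg fun _ _ => by positivity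

theorem ae_resolventNormSqLaw_nonneg (N : ℕ) (z : ℂ) (n : ℕ) :
    ∀ᵐ s ∂(resolventNormSqLaw N z n), 0 ≤ s := by
  rw [resolventNormSqLaw, ae_map_iff (measurable_resolventNormSq_prod z n).aemeasurable
    measurableSet_Ici]
  exact ae_of_all _ fun _ => resolventNormSq_nonneg _ _ _

section JointLaw

open Matrix

/-- The pair formed by `‖(z 1 - M')⁻¹ c‖²` and the opposite of `M₁₁ + r (z 1 - M')⁻¹ c`, where
`M'`, `c` and `r` are the lower right block, first column and first row of `M`. -/
noncomputable def schurPair {n : ℕ} (z : ℂ) (M : Matrix (Fin (n + 1)) (Fin (n + 1)) ℂ) : ℝ × ℂ :=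
  (resolventNormSq z (M.submatrix Fin.succ Fin.succ) fun i => M i.succ 0, schurDenominator z M - z)

theorem measurable_schurPair {α : Type*} [MeasurableSpace α] {n : ℕ} (z : ℂ)
    {M : α → Matrix (Fin (n + 1)) (Fin (n + 1)) ℂ} (hM : ∀ i j, Measurable fun a => M a i j) :
    Measurable fun a => schurPair z (M a) := by
  refine (measurable_resolventNormSq (fun i j => hM _ _) (fun i => hM _ _) z).prodMk ?_
  unfold schurDenominator
  refine ((((hM 0 0).const_sub z).sub (Finset.measurable_sum _ fun j _ => ?_)).sub_const z)
  exact (hM _ _).mul (measurable_resolvent_mulVec (fun i j => hM _ _) (fun i => hM _ _) z j)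

theorem schurDenominator_sub {n : ℕ} (z : ℂ) (M : Matrix (Fin (n + 1)) (Fin (n + 1)) ℂ) :
    schurDenominator z M - z = (-Fin.cons (α := fun _ => ℂ) 1
      ((z • (1 : Matrix (Fin n) (Fin n) ℂ) - M.submatrix Fin.succ Fin.succ)⁻¹ *ᵥ
        fun i => M i.succ 0)) ⬝ᵥ fun j => M 0 j := by
  rw [neg_dotProduct, dotProduct, Fin.sum_univ_succ]
  simp only [Fin.cons_zero, Fin.cons_succ, one_mul, schurDenominator, mul_comm (M 0 _)]
  ring

/-- The first row is independent of (c, M'), hence of the coefficients (1, w) against which it is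
paired. Only measurability of w is used, not invertibility of z - M', so the identity can serve to
prove almost sure invertibility. -/
theorem map_schurPair_gaussianPi (N : ℕ) (z : ℂ) (n : ℕ) :
    (gaussianPi (Fin (n + 1) × Fin (n + 1)) (1 / (N : ℝ≥0))).map
      (fun x => schurPair z (Matrix.of (Function.curry x)))
      = resolventNormSqLaw N z n ⊗ₘ varianceKernel N := by
  set v : ℝ≥0 := 1 / (N : ℝ≥0) with hv
  let w : (Fin n → ℂ) × (Fin n × Fin n → ℂ) → Fin n → ℂ := fun q =>
    (z • (1 : Matrix (Fin n) (Fin n) ℂ) - Matrix.of (Function.curry q.2))⁻¹ *ᵥ q.1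
  let η : (Fin n → ℂ) × (Fin n × Fin n → ℂ) → Fin (n + 1) → ℂ := fun q => -Fin.cons (α := fun _ => ℂ) 1 (w q)
  let T : (Fin n → ℂ) × (Fin n × Fin n → ℂ) → ℝ := fun q =>
    resolventNormSq z (Matrix.of (Function.curry q.2)) q.1
  have hT : Measurable T := measurable_resolventNormSq_prod z n
  have hw : ∀ j, Measurable fun q => w q j := fun j =>
    measurable_resolvent_mulVec (fun i j => by simp only [Matrix.of_apply, Function.curry]; fun_prop)
      (fun i => by fun_prop) z j
  have hη : ∀ j, Measurable fun q => η q j := fun j => by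
    refine Fin.cases ?_ (fun j => ?_) j
    · simp only [η, Pi.neg_apply, Fin.cons_zero]
      exact measurable_const
    · exact (hw j).neg
  have hF : Measurable fun p : (Fin (n + 1) → ℂ) × ((Fin n → ℂ) × (Fin n × Fin n → ℂ)) =>
      (T p.2, η p.2 ⬝ᵥ p.1) := by
    refine (hT.comp measurable_snd).prodMk ?_
    unfold dotProduct
    exact Finset.measurable_sum _ fun j _ => ((hη j).comp measurable_snd).mul (by fun_prop)
  have hcomp : (fun x => schurPair z (Matrix.of (Function.curry x)))
      = (fun p : (Fin (n + 1) → ℂ) × ((Fin n → ℂ) × (Fin n × Fin n → ℂ)) =>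
        (T p.2, η p.2 ⬝ᵥ p.1)) ∘ (fun x : Fin (n + 1) × Fin (n + 1) → ℂ =>
        ((fun j => x (0, j)), ((fun i : Fin n => x (i.succ, 0)),
          fun p : Fin n × Fin n => x (p.1.succ, p.2.succ)))) := by
    funext x
    exact Prod.ext rfl (schurDenominator_sub z (Matrix.of (Function.curry x)))
  rw [hcomp, ← Measure.map_map hF (measurePreserving_blocks_gaussianPi n v).measurable,
    (measurePreserving_blocks_gaussianPi n v).map_eq]
  refine Measure.ext_of_lintegral _ fun f hf => ?_
  -- Fubini with the first row innermost: for frozen q = (c, M') the first component is constant and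
  -- the second is a Gaussian linear form.
  rw [lintegral_map hf hF, lintegral_prod_symm'
      (fun p : (Fin (n + 1) → ℂ) × ((Fin n → ℂ) × (Fin n × Fin n → ℂ)) => f (T p.2, η p.2 ⬝ᵥ p.1))
      (hf.comp hF), Measure.lintegral_compProd hf,
    resolventNormSqLaw, lintegral_map hf.lintegral_kernel_prod_right' hT]
  refine lintegral_congr fun q => ?_
  have hk : varianceKernel N (T q)
      = (gaussianPi (Fin (n + 1)) v).map fun x => η q ⬝ᵥ x := by
    rw [map_dotProduct_gaussianPi]
    change complexGaussian 0 _ = _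
    congr 1
    -- The summand 1 is the contribution of the corner entry `M 0 0`, whose coefficient is -1.
    have : (1 + T q) / N = ((v * ∑ i, ‖η q i‖₊ ^ 2 : ℝ≥0) : ℝ) := by
      push_cast
      rw [Fin.sum_univ_succ]
      simp [η, T, resolventNormSq, hv, w]
      ring
    rw [this, Real.toNNReal_coe]
  have hm : Measurable fun x : Fin (n + 1) → ℂ => η q ⬝ᵥ x := by unfold dotProduct; fun_prop
  rw [hk, lintegral_map (by fun_prop) hm]

theorem varianceKernel_apply (N : ℕ) (s : ℝ) :
    varianceKernel N s = complexGaussian 0 (Real.toNNReal ((1 + s) / N)) := rfl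

theorem ae_compProd_varianceKernel_ne {N : ℕ} (hN : N ≠ 0) (z : ℂ) (n : ℕ) :
    ∀ᵐ p ∂(resolventNormSqLaw N z n ⊗ₘ varianceKernel N), z + p.2 ≠ 0 := by
  have hm : MeasurableSet {p : ℝ × ℂ | z + p.2 ≠ 0} :=
    (measurableSet_eq_fun (by fun_prop) (by fun_prop)).compl
  rw [Measure.ae_compProd_iff hm]
  filter_upwards [ae_resolventNormSqLaw_nonneg N z n] with s hs
  have : (0 : ℝ) < N := by positivity
  have h0 : Real.toNNReal ((1 + s) / N) ≠ 0 := by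
    rw [Ne, Real.toNNReal_eq_zero, not_le]
    positivity
  rw [varianceKernel_apply]
  filter_upwards [ae_complexGaussian_ne h0 (-z)] with y hy h
  exact hy (eq_neg_of_add_eq_zero_right h)

/-- The denominator is nonzero because, given the rest, it is Gaussian of positive variance.
Together with invertibility of the minor this makes the full matrix invertible, which is the minor's
invertibility one size up. -/
theorem ae_isUnit_and_schurDenominator_ne_zero {N : ℕ} (hN : N ≠ 0) (z : ℂ) (n : ℕ) :
    ∀ᵐ x ∂(gaussianPi (Fin (n + 1) × Fin (n + 1)) (1 / (N : ℝ≥0))),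
      IsUnit (z • (1 : Matrix (Fin n) (Fin n) ℂ)
        - (Matrix.of (Function.curry x)).submatrix Fin.succ Fin.succ) ∧
      schurDenominator z (Matrix.of (Function.curry x)) ≠ 0 := by
  induction n with
  | zero =>
    have hpair := measurable_schurPair z (M := fun x : Fin 1 × Fin 1 → ℂ =>
      Matrix.of (Function.curry x)) (fun i j => by
        simp only [Matrix.of_apply, Function.curry]; fun_prop)
    have h := ae_compProd_varianceKernel_ne hN z 0
    rw [← map_schurPair_gaussianPi] at h
    filter_upwards [ae_of_ae_map hpair.aemeasurable h] with x hx
    exact ⟨isUnit_of_subsingleton _, by simpa [schurPair] using hx⟩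
  | succ n ih =>
    have hpair := measurable_schurPair z (M := fun x : Fin (n + 2) × Fin (n + 2) → ℂ =>
      Matrix.of (Function.curry x)) (fun i j => by
        simp only [Matrix.of_apply, Function.curry]; fun_prop)
    have h := ae_compProd_varianceKernel_ne hN z (n + 1)
    rw [← map_schurPair_gaussianPi] at h
    have hsub : ∀ᵐ x ∂(gaussianPi (Fin (n + 2) × Fin (n + 2)) (1 / (N : ℝ≥0))),
        IsUnit (z • (1 : Matrix (Fin (n + 1)) (Fin (n + 1)) ℂ)
          - (Matrix.of (Function.curry x)).submatrix Fin.succ Fin.succ) := by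
      have h1 := (measurePreserving_blocks_gaussianPi (n + 1) (1 / (N : ℝ≥0)))
      have h2 : ∀ᵐ x ∂(gaussianPi (Fin (n + 1) × Fin (n + 1)) (1 / (N : ℝ≥0))),
        IsUnit (z • (1 : Matrix (Fin (n + 1)) (Fin (n + 1)) ℂ) - Matrix.of (Function.curry x)) := by
        filter_upwards [ih] with x hx
        exact (isUnit_of_schurDenominator_ne_zero hx.1 hx.2).1
      exact h1.quasiMeasurePreserving.ae (Measure.quasiMeasurePreserving_snd.ae
        (Measure.quasiMeasurePreserving_snd.ae h2))
    filter_upwards [ae_of_ae_map hpair.aemeasurable h, hsub] with x hx hs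
    exact ⟨hs, by simpa [schurPair] using hx⟩

/-- The recursion: rotate c to a multiple of e₁, absorb the rotation into the law of the matrix,
then apply the Schur formula for ‖(z - M)⁻¹e₁‖². Here g stands for ‖c‖², s for the lower-dimensional
variable and z + y for the Schur denominator. -/
theorem lintegral_resolventNormSqLaw_succ {N : ℕ} (hN : N ≠ 0) (z : ℂ) (m : ℕ) {f : ℝ → ℝ≥0∞}
    (hf : Measurable f) :
    ∫⁻ t, f t ∂(resolventNormSqLaw N z (m + 1)) = ∫⁻ s, ∫⁻ y, ∫⁻ g,
      f (g * ((1 + s) / ‖z + y‖ ^ 2)) ∂(gammaMeasure (m + 1) N) ∂(varianceKernel N s)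
        ∂(resolventNormSqLaw N z m) := by
  set v : ℝ≥0 := 1 / (N : ℝ≥0) with hv
  have hv0 : v ≠ 0 := by positivity
  have hgamma : (gaussianPi (Fin (m + 1)) v).map (fun x => ∑ i, ‖x i‖ ^ 2)
      = gammaMeasure (m + 1) N := by
    rw [map_sum_norm_sq_gaussianPi m hv0]
    congr 1
    simp [hv]
  have := isProbabilityMeasure_gammaMeasure (a := (m : ℝ) + 1) (r := N) (by positivity)
    (by positivity)
  let S : (Fin (m + 1) × Fin (m + 1) → ℂ) → ℝ := fun x =>
    resolventNormSq z (Matrix.of (Function.curry x)) (Pi.single 0 1)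
  have hS : Measurable S := measurable_resolventNormSq
    (fun i j => by simp only [Matrix.of_apply, Function.curry]; fun_prop) (fun i => by fun_prop) z
  have hpair := measurable_schurPair z (M := fun x : Fin (m + 1) × Fin (m + 1) → ℂ =>
    Matrix.of (Function.curry x)) (fun i j => by
      simp only [Matrix.of_apply, Function.curry]; fun_prop)
  have hrot : ∀ c : Fin (m + 1) → ℂ,
      ∫⁻ x, f (resolventNormSq z (Matrix.of (Function.curry x)) c)
          ∂(gaussianPi (Fin (m + 1) × Fin (m + 1)) v)
        = ∫⁻ x, f ((∑ i, ‖c i‖ ^ 2) * S x) ∂(gaussianPi (Fin (m + 1) × Fin (m + 1)) v) := by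
    intro c
    set r : ℝ := √(∑ i, ‖c i‖ ^ 2) with hr
    have hr2 : r ^ 2 = ∑ i, ‖c i‖ ^ 2 := Real.sq_sqrt (Finset.sum_nonneg fun _ _ => by positivity)
    -- A zero vector has no direction to rotate, but then both sides are f 0.
    rcases eq_or_ne r 0 with h0 | h0
    · have hc : c = 0 := by
        rw [h0, zero_pow two_ne_zero, eq_comm,
          Finset.sum_eq_zero_iff_of_nonneg fun _ _ => by positivity] at hr2
        funext i
        simpa using hr2 i (Finset.mem_univ i)
      simp [hc, resolventNormSq]
    · have hrc : (r : ℂ) ≠ 0 := by exact_mod_cast h0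
      obtain ⟨U, hU, hUc⟩ := exists_unitary_mulVec_single (0 : Fin (m + 1)) ((r : ℂ)⁻¹ • c) (by
        simp only [Pi.smul_apply, smul_eq_mul, norm_mul, mul_pow, ← Finset.mul_sum, ← hr2]
        rw [norm_inv, Complex.norm_real, Real.norm_eq_abs, inv_pow, sq_abs]
        exact inv_mul_cancel₀ (pow_ne_zero 2 h0))
      have hc : c = (r : ℂ) • (U *ᵥ Pi.single 0 1) := by rw [hUc, smul_inv_smul₀ hrc]
      have hconj : Measurable fun (x : Fin (m + 1) × Fin (m + 1) → ℂ) (p : Fin (m + 1) × Fin (m + 1)) =>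
          (star U * Matrix.of (Function.curry x) * U) p.1 p.2 := by
        refine measurable_pi_lambda _ fun p => ?_
        simp only [Matrix.mul_apply, Matrix.of_apply, Function.curry]
        fun_prop
      have e : ∀ x, resolventNormSq z (Matrix.of (Function.curry x)) c
          = (∑ i, ‖c i‖ ^ 2) * S fun p => (star U * Matrix.of (Function.curry x) * U) p.1 p.2 := by
        intro x
        conv_lhs => rw [hc]
        rw [resolventNormSq_smul, resolventNormSq_unitary hU, Complex.norm_real, Real.norm_eq_abs,
          sq_abs, hr2]
        rfl
      simp_rw [e]
      rw [← lintegral_map (f := fun x => f ((∑ i, ‖c i‖ ^ 2) * S x)) (by fun_prop) hconj,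
        map_conj_gaussianPi v hU]
  have hS' : ∀ g : ℝ, ∫⁻ x, f (g * S x) ∂(gaussianPi (Fin (m + 1) × Fin (m + 1)) v)
      = ∫⁻ p, f (g * ((1 + p.1) / ‖z + p.2‖ ^ 2))
        ∂(resolventNormSqLaw N z m ⊗ₘ varianceKernel N) := by
    intro g
    rw [← map_schurPair_gaussianPi, lintegral_map (by fun_prop) hpair]
    refine lintegral_congr_ae ?_
    filter_upwards [ae_isUnit_and_schurDenominator_ne_zero hN z m] with x hx
    simp only [S, resolventNormSq_single hx.1 hx.2, schurPair, add_sub_cancel]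
  rw [resolventNormSqLaw, lintegral_map hf (measurable_resolventNormSq_prod z _),
    lintegral_prod (fun p : (Fin (m + 1) → ℂ) × (Fin (m + 1) × Fin (m + 1) → ℂ) =>
      f (resolventNormSq z (Matrix.of (Function.curry p.2)) p.1))
      (hf.comp (measurable_resolventNormSq_prod z _)).aemeasurable]
  simp_rw [← hv, hrot]
  rw [← lintegral_map (f := fun g => ∫⁻ x, f (g * S x) ∂(gaussianPi (Fin (m + 1) × Fin (m + 1)) v))
    (Measurable.lintegral_prod_right (by fun_prop)) (by fun_prop), hgamma]
  simp_rw [hS']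
  rw [lintegral_lintegral_swap (by fun_prop), Measure.lintegral_compProd
    (Measurable.lintegral_prod_right (by fun_prop))]

end JointLaw

/-! ### Noncentral squared norms and the transition density -/

section NoncentralChiSquared

theorem hasSum_poisson (y : ℝ) :
    HasSum (fun k : ℕ => Real.exp (-y) * (y ^ k / k.factorial)) 1 := by
  have h := (NormedSpace.expSeries_div_hasSum_exp y).mul_left (Real.exp (-y))
  rwa [← Real.exp_eq_exp_ℝ, ← Real.exp_add, neg_add_cancel, Real.exp_zero] at h

/-- The squared norm of a noncentral complex Gaussian variable is a Poisson mixture of Gamma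
variables. -/
theorem map_norm_sq_complexGaussian {w : ℝ≥0} (hw : w ≠ 0) (z : ℂ) :
    (complexGaussian 0 w).map (fun y => ‖z + y‖ ^ 2 / w)
      = Measure.sum fun k : ℕ =>
        ENNReal.ofReal (Real.exp (-(‖z‖ ^ 2 / w)) * ((‖z‖ ^ 2 / w) ^ k / k.factorial))
          • gammaMeasure (k + 1) 1 := by
  have hw' : (0 : ℝ) < w := by positivity
  have hwc : (w : ℂ) ≠ 0 := by exact_mod_cast hw'.ne'
  set b : ℝ := ‖z‖ ^ 2 / w with hb
  have hb0 : 0 ≤ b := by positivity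
  have hp : ∀ k : ℕ, 0 ≤ Real.exp (-b) * (b ^ k / k.factorial) := fun k => by positivity
  have hgm : ∀ k : ℕ, IsProbabilityMeasure (gammaMeasure ((k : ℝ) + 1) 1) := fun k =>
    isProbabilityMeasure_gammaMeasure (by positivity) one_pos
  have hm : Measurable fun y : ℂ => ‖z + y‖ ^ 2 / (w : ℝ) := by fun_prop
  have := Measure.isProbabilityMeasure_map (μ := complexGaussian 0 w) hm.aemeasurable
  have hfin : IsFiniteMeasure (Measure.sum fun k : ℕ =>
      ENNReal.ofReal (Real.exp (-b) * (b ^ k / k.factorial)) • gammaMeasure ((k : ℝ) + 1) 1) := by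
    constructor
    rw [Measure.sum_apply _ MeasurableSet.univ]
    simp only [Measure.smul_apply, measure_univ, smul_eq_mul, mul_one]
    rw [← ENNReal.ofReal_tsum_of_nonneg hp (hasSum_poisson b).summable]
    exact ENNReal.ofReal_lt_top
  refine Measure.ext_of_charFun (funext fun ξ => ?_)
  rw [charFun_apply_real, charFun_apply_real]
  simp_rw [← Complex.ofReal_mul]
  have hre : (1 - ξ * Complex.I : ℂ) ≠ 0 := fun h => by
    have := congrArg Complex.re h
    simp at this
  have hint : Integrable (fun x : ℝ => Complex.exp (((ξ * x : ℝ) : ℂ) * Complex.I))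
      (Measure.sum fun k : ℕ =>
        ENNReal.ofReal (Real.exp (-b) * (b ^ k / k.factorial)) • gammaMeasure ((k : ℝ) + 1) 1) := by
    refine Integrable.of_bound (C := 1) (by fun_prop) (ae_of_all _ fun x => ?_)
    rw [Complex.norm_exp_ofReal_mul_I]
  have hs := hasSum_integral_measure hint
  simp_rw [integral_smul_measure, ENNReal.toReal_ofReal (hp _),
    integral_cexp_gammaMeasure_nat _ one_pos] at hs
  refine HasSum.unique ?_ hs
  rw [integral_map hm.aemeasurable (by fun_prop)]
  have e : ∀ y : ℂ, ξ * (‖z + y‖ ^ 2 / (w : ℝ)) = (ξ / w) * ‖z + y‖ ^ 2 := fun y => by ring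
  simp_rw [e]
  rw [integral_cexp_normSq_complexGaussian w hw]
  -- Since iξq = q - 1, the noncentral characteristic function is q exp(b(q - 1)). Expanding exp(bq)
  -- gives Poisson weights times qᵏ⁺¹, the characteristic function of Gamma(k + 1, 1).
  set q : ℂ := (1 - ξ * Complex.I)⁻¹ with hq
  have hq1 : q - 1 = ξ * Complex.I * q := by
    rw [hq]; field_simp; ring
  have h2 := ((NormedSpace.expSeries_div_hasSum_exp ((b : ℂ) * q)).mul_left
    (Complex.exp (-(b : ℂ)) * q))
  rw [← Complex.exp_eq_exp_ℂ] at h2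
  have h3 : (w : ℂ) * (ξ / w : ℝ) = ξ := by push_cast; field_simp
  have h4 : Complex.exp (-(b : ℂ)) * q * Complex.exp ((b : ℂ) * q)
      = q * Complex.exp ((ξ / w : ℝ) * (‖z‖ ^ 2 : ℝ) * Complex.I / (1 - ξ * Complex.I)) := by
    rw [mul_comm (Complex.exp _) q, mul_assoc, ← Complex.exp_add]
    congr 2
    have : (-(b : ℂ) + b * q) = b * (q - 1) := by ring
    rw [this, hq1, hb, hq]
    push_cast
    field_simp
  rw [h3, ← hq, ← h4]
  refine h2.congr_fun fun k => ?_
  rw [Complex.real_smul]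
  push_cast
  rw [div_one, ← hq]
  ring

theorem lintegral_pow_mul_exp_gammaMeasure (k m : ℕ) {t : ℝ} (ht : 0 < t) :
    ∫⁻ x, ENNReal.ofReal (x ^ (m + 1) * (t ^ m / m.factorial * Real.exp (-(x * t))))
        ∂(gammaMeasure (k + 1) 1)
      = ENNReal.ofReal (t ^ m / m.factorial
        * ((k + m + 1).factorial / k.factorial / (1 + t) ^ (k + m + 2))) := by
  rw [lintegral_gammaMeasure_nat k 1 (by fun_prop)]
  -- Up to constants the integrand is the Gamma density of shape k + m + 2 and rate 1 + t, so its
  -- total mass 1 evaluates the integral.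
  have h := lintegral_gammaMeasure_nat (k + m + 1) (1 + t) (f := fun _ => 1) (by fun_prop)
  have := isProbabilityMeasure_gammaMeasure (a := ((k + m + 1 : ℕ) : ℝ) + 1) (r := 1 + t)
    (by positivity) (by positivity)
  rw [lintegral_one, measure_univ] at h
  simp_rw [mul_one] at h
  rw [← mul_one (ENNReal.ofReal (t ^ m / _ * _)), h, ← lintegral_const_mul _ (by fun_prop)]
  refine setLIntegral_congr_fun measurableSet_Ioi fun x hx => ?_
  have hx' : (0 : ℝ) < x := hx
  have hf : ((k + m + 1).factorial : ℝ) ≠ 0 := by positivity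
  rw [← ENNReal.ofReal_mul (by positivity), ← ENNReal.ofReal_mul (by positivity)]
  congr 1
  have he : Real.exp (-((1 + t) * x)) = Real.exp (-(1 * x)) * Real.exp (-(x * t)) := by
    rw [← Real.exp_add]; congr 1; ring
  rw [he]
  have ht1 : (1 + t) ≠ 0 := by positivity
  field_simp
  ring

theorem lintegral_mul_gammaMeasure (m : ℕ) {r b : ℝ} (hr : 0 < r) (hb : 0 < b) {f : ℝ → ℝ≥0∞}
    (hf : Measurable f) :
    ∫⁻ g, f (g * b) ∂(gammaMeasure (m + 1) r) = ∫⁻ t in Set.Ioi 0,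
      f t * ENNReal.ofReal ((r / b) ^ (m + 1) * (t ^ m / m.factorial * Real.exp (-(r / b * t)))) := by
  rw [lintegral_gammaMeasure_nat m r (by fun_prop)]
  have himg : (fun t : ℝ => b⁻¹ * t) '' Set.Ioi 0 = Set.Ioi 0 := by
    rw [Set.image_const_mul_Ioi_zero (by positivity)]
  conv_lhs => rw [← himg]
  rw [lintegral_image_eq_lintegral_abs_deriv_mul (f' := fun _ => b⁻¹) measurableSet_Ioi
    (fun x _ => by simpa using ((hasDerivAt_id x).const_mul b⁻¹).hasDerivWithinAt)
    (fun x _ y _ h => by simpa [hb.ne'] using h)]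
  refine setLIntegral_congr_fun measurableSet_Ioi fun t ht => ?_
  have ht' : (0 : ℝ) < t := ht
  rw [← mul_assoc, ← ENNReal.ofReal_mul (by positivity), mul_comm (f t), abs_of_pos (by positivity)]
  have h1 : b⁻¹ * t * b = t := by field_simp
  have h2 : r * (b⁻¹ * t) = r / b * t := by field_simp
  rw [h1, h2]
  congr 2
  rw [mul_pow, div_pow, pow_succ r, pow_succ b, inv_pow]
  field_simp

end NoncentralChiSquared

/-- Given y, the variable t is Gamma with shape m + 1 and random rate x = |z + y|²N/(1 + s), and x
is a Poisson mixture of Gamma laws. Integrating x out leaves terms in which s and t are separated,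
so s can later be averaged term by term. -/
theorem lintegral_varianceKernel_gammaMeasure {N : ℕ} (hN : N ≠ 0) (z : ℂ) (m : ℕ) {s : ℝ}
    (hs : 0 ≤ s) {f : ℝ → ℝ≥0∞} (hf : Measurable f) :
    ∫⁻ y, ∫⁻ g, f (g * ((1 + s) / ‖z + y‖ ^ 2)) ∂(gammaMeasure (m + 1) N) ∂(varianceKernel N s)
      = ∫⁻ t in Set.Ioi 0, f t * ∑' k : ℕ,
        ENNReal.ofReal (Real.exp (-(N * ‖z‖ ^ 2 / (1 + s))) * (1 / (1 + s)) ^ k)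
        * ENNReal.ofReal ((N * ‖z‖ ^ 2) ^ k / k.factorial * (t ^ m / m.factorial
          * ((k + m + 1).factorial / k.factorial / (1 + t) ^ (k + m + 2)))) := by
  have hN' : (0 : ℝ) < N := by positivity
  set w : ℝ≥0 := Real.toNNReal ((1 + s) / N) with hw
  have hwr : (w : ℝ) = (1 + s) / N := Real.coe_toNNReal _ (by positivity)
  have hw0 : w ≠ 0 := by
    rw [hw, Ne, Real.toNNReal_eq_zero, not_le]
    positivity
  rw [varianceKernel_apply, ← hw]
  have h1 : ∀ᵐ y ∂(complexGaussian 0 w),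
      ∫⁻ g, f (g * ((1 + s) / ‖z + y‖ ^ 2)) ∂(gammaMeasure (m + 1) N) = ∫⁻ t in Set.Ioi 0,
        f t * ENNReal.ofReal ((‖z + y‖ ^ 2 / w) ^ (m + 1)
          * (t ^ m / m.factorial * Real.exp (-(‖z + y‖ ^ 2 / w * t)))) := by
    filter_upwards [ae_complexGaussian_ne hw0 (-z)] with y hy
    have hy' : 0 < ‖z + y‖ := norm_pos_iff.2 fun h => hy (eq_neg_of_add_eq_zero_right h)
    rw [lintegral_mul_gammaMeasure m hN' (by positivity) hf]
    -- The Gamma rate N and the variance (1 + s)/N combine into exactly the normalisation of the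
    -- Poisson mixture.
    have : (N : ℝ) / ((1 + s) / ‖z + y‖ ^ 2) = ‖z + y‖ ^ 2 / w := by
      rw [hwr]; field_simp
    rw [this]
  rw [lintegral_congr_ae h1, lintegral_lintegral_swap (by fun_prop)]
  refine setLIntegral_congr_fun measurableSet_Ioi fun t ht => ?_
  have ht' : (0 : ℝ) < t := ht
  rw [lintegral_const_mul _ (by fun_prop)]
  congr 1
  rw [← lintegral_map (f := fun x : ℝ => ENNReal.ofReal (x ^ (m + 1)
    * (t ^ m / m.factorial * Real.exp (-(x * t))))) (g := fun y : ℂ => ‖z + y‖ ^ 2 / (w : ℝ))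
    (by fun_prop) (by fun_prop), map_norm_sq_complexGaussian hw0, lintegral_sum_measure]
  refine tsum_congr fun k => ?_
  rw [lintegral_smul_measure, lintegral_pow_mul_exp_gammaMeasure k m ht', smul_eq_mul,
    ← ENNReal.ofReal_mul (by positivity), ← ENNReal.ofReal_mul (by positivity)]
  congr 1
  have : ‖z‖ ^ 2 / (w : ℝ) = N * ‖z‖ ^ 2 / (1 + s) := by rw [hwr]; field_simp
  rw [this]
  ring

theorem lintegral_resolventNormSqLaw_succ_eq_tsum {N : ℕ} (hN : N ≠ 0) (z : ℂ) (m : ℕ)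
    {f : ℝ → ℝ≥0∞} (hf : Measurable f) :
    ∫⁻ t, f t ∂(resolventNormSqLaw N z (m + 1)) = ∫⁻ t in Set.Ioi 0, f t * ∑' k : ℕ,
      (∫⁻ s, ENNReal.ofReal (Real.exp (-(N * ‖z‖ ^ 2 / (1 + s))) * (1 / (1 + s)) ^ k)
        ∂(resolventNormSqLaw N z m))
      * ENNReal.ofReal ((N * ‖z‖ ^ 2) ^ k / k.factorial * (t ^ m / m.factorial
          * ((k + m + 1).factorial / k.factorial / (1 + t) ^ (k + m + 2)))) := by
  rw [lintegral_resolventNormSqLaw_succ hN z m hf, lintegral_congr_ae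
    ((ae_resolventNormSqLaw_nonneg N z m).mono fun s hs =>
      lintegral_varianceKernel_gammaMeasure hN z m hs hf), lintegral_lintegral_swap]
  · refine lintegral_congr fun t => ?_
    rw [lintegral_const_mul _ (Measurable.tsum fun k => by fun_prop),
      lintegral_tsum fun k => by fun_prop]
    congr 1
    refine tsum_congr fun k => ?_
    rw [lintegral_mul_const _ (by fun_prop)]
  · refine Measurable.aemeasurable ((hf.comp measurable_snd).mul ?_)
    exact Measurable.tsum fun k => by fun_prop

/-! ### Incomplete Gamma function: recurrence and lower bound -/

section UpperIncompleteGamma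

theorem integrableOn_rpow_mul_exp_neg {s a : ℝ} (hs : 0 < s) (ha : 0 ≤ a) :
    IntegrableOn (fun u : ℝ => u ^ (s - 1) * Real.exp (-u)) (Set.Ioi a) := by
  have h := (Real.GammaIntegral_convergent hs).mono_set (Set.Ioi_subset_Ioi ha)
  simpa [mul_comm] using h

theorem upperIncompleteGamma_nonneg (s : ℝ) {a : ℝ} (ha : 0 ≤ a) : 0 ≤ upperIncompleteGamma s a :=
  setIntegral_nonneg measurableSet_Ioi fun u hu => by
    have : 0 < u := lt_of_le_of_lt ha hu
    positivity

theorem upperIncompleteGamma_one (a : ℝ) : upperIncompleteGamma 1 a = Real.exp (-a) := by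
  simp only [upperIncompleteGamma, sub_self, Real.rpow_zero, one_mul]
  exact integral_exp_neg_Ioi a

theorem upperIncompleteGamma_succ (n : ℕ) {a : ℝ} (ha : 0 ≤ a) :
    upperIncompleteGamma (n + 1 : ℕ) a
      = n * upperIncompleteGamma n a + a ^ n * Real.exp (-a) := by
  -- For n = 0 the term in Γ(0, a) carries the factor 0, and the identity reduces to Γ(1, a) = e⁻ᵃ.
  rcases n with _ | n
  · simpa using upperIncompleteGamma_one a
  have hi := fun k : ℕ => integrableOn_rpow_mul_exp_neg (s := ((k + 1 : ℕ) : ℝ)) (by positivity) ha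
  have hpow : ∀ k : ℕ, ∀ u : ℝ, u ^ (((k + 1 : ℕ) : ℝ) - 1) = u ^ k := fun k u => by
    rw [Nat.cast_add, Nat.cast_one, add_sub_cancel_right, Real.rpow_natCast]
  simp only [hpow] at hi
  simp only [upperIncompleteGamma, hpow]
  have hlim : Filter.Tendsto (fun u : ℝ => u ^ (n + 1) * Real.exp (-u)) Filter.atTop (nhds 0) :=
    Real.tendsto_pow_mul_exp_neg_atTop_nhds_zero (n + 1)
  have h := integral_Ioi_of_hasDerivAt_of_tendsto' (a := a) (m := 0)
      (f := fun u : ℝ => u ^ (n + 1) * Real.exp (-u))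
      (f' := fun u : ℝ => ((n + 1 : ℕ) : ℝ) * (u ^ n * Real.exp (-u)) - u ^ (n + 1) * Real.exp (-u))
      (fun u _ => by
        refine ((hasDerivAt_pow (n + 1) u).mul (hasDerivAt_neg u).exp).congr_deriv ?_
        simp only [Nat.add_sub_cancel]
        ring)
      (((hi n).const_mul _).sub (hi (n + 1))) hlim
  rw [integral_sub ((hi n).const_mul _) (hi (n + 1)), integral_const_mul] at h
  linarith

/-- The extra factor u is at least a on the domain of integration. Positivity of the density and of
the moments rests on this. -/
theorem mul_upperIncompleteGamma_le (n : ℕ) {a : ℝ} (ha : 0 ≤ a) (hn : n ≠ 0) :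
    a * upperIncompleteGamma n a ≤ upperIncompleteGamma (n + 1 : ℕ) a := by
  have hn' : (0 : ℝ) < n := by positivity
  rw [upperIncompleteGamma, ← integral_const_mul]
  refine setIntegral_mono_on ((integrableOn_rpow_mul_exp_neg hn' ha).const_mul a)
    (integrableOn_rpow_mul_exp_neg (by positivity) ha) measurableSet_Ioi fun u hu => ?_
  have hu' : a < u := hu
  have hu0 : 0 < u := lt_of_le_of_lt ha hu'
  have e : u ^ (((n + 1 : ℕ) : ℝ) - 1) = u * u ^ ((n : ℝ) - 1) := by
    rw [Nat.cast_add, Nat.cast_one, add_sub_cancel_right, Real.rpow_sub_one hu0.ne']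
    field_simp
  rw [e, mul_assoc]
  exact mul_le_mul_of_nonneg_right hu'.le (by positivity)

end UpperIncompleteGamma

/-- The function `n ↦ Γ(n, a) e^a`. -/
noncomputable def scaledGamma (a : ℝ) (n : ℕ) : ℝ := upperIncompleteGamma n a * Real.exp a

section ScaledGamma

theorem scaledGamma_nonneg {a : ℝ} (ha : 0 ≤ a) (n : ℕ) : 0 ≤ scaledGamma a n :=
  mul_nonneg (upperIncompleteGamma_nonneg _ ha) (Real.exp_pos _).le

theorem scaledGamma_succ {a : ℝ} (ha : 0 ≤ a) (n : ℕ) : scaledGamma a (n + 1) = n * scaledGamma a n + a ^ n := by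
  rw [scaledGamma, upperIncompleteGamma_succ n ha, add_mul, mul_assoc (a ^ n), ← Real.exp_add,
    neg_add_cancel, Real.exp_zero, scaledGamma]
  ring

theorem mul_scaledGamma_le {a : ℝ} (ha : 0 ≤ a) (n : ℕ) (hn : n ≠ 0) : a * scaledGamma a n ≤ scaledGamma a (n + 1) := by
  rw [scaledGamma, scaledGamma, ← mul_assoc]
  exact mul_le_mul_of_nonneg_right (mul_upperIncompleteGamma_le n ha hn) (Real.exp_pos _).le

end ScaledGamma

/-! ### Beta integrals on the half-line -/

section BetaIntegral

theorem hasDerivAt_pow_div_one_add_pow (p r : ℕ) {s : ℝ} (hs : 1 + s ≠ 0) :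
    HasDerivAt (fun s : ℝ => s ^ (p + 1) / (1 + s) ^ r)
      ((p + 1 : ℕ) * (s ^ p / (1 + s) ^ r) - r * (s ^ (p + 1) / (1 + s) ^ (r + 1))) s := by
  have h1 : HasDerivAt (fun s : ℝ => 1 + s) 1 s := (hasDerivAt_id s).const_add 1
  refine ((hasDerivAt_pow (p + 1) s).div (h1.pow r) (pow_ne_zero _ hs)).congr_deriv ?_
  rcases r with _ | r
  · simp
  · simp only [Nat.add_sub_cancel, Pi.pow_apply]
    field_simp
    ring

theorem integrableOn_and_integral_inv_one_add_pow (q : ℕ) :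
    IntegrableOn (fun s : ℝ => 1 / (1 + s) ^ (q + 2)) (Set.Ioi 0) ∧
    ∫ s in Set.Ioi (0 : ℝ), 1 / (1 + s) ^ (q + 2) = 1 / (q + 1) := by
  have hd : ∀ s ∈ Set.Ici (0 : ℝ), HasDerivAt (fun s : ℝ => -(1 / (q + 1)) * (1 / (1 + s) ^ (q + 1)))
      (1 / (1 + s) ^ (q + 2)) s := by
    intro s hs
    have hs' : (0 : ℝ) ≤ s := hs
    have h1 : HasDerivAt (fun s : ℝ => 1 + s) 1 s := (hasDerivAt_id s).const_add 1
    have hne : 1 + s ≠ 0 := by positivity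
    have h2 := (((hasDerivAt_const s (1 : ℝ)).div (h1.pow (q + 1)) (pow_ne_zero _ hne))).const_mul
      (-(1 / ((q : ℝ) + 1)))
    refine h2.congr_deriv ?_
    simp only [Nat.add_sub_cancel, Pi.pow_apply]
    push_cast
    field_simp
    ring
  have hpos : ∀ s ∈ Set.Ioi (0 : ℝ), 0 ≤ 1 / (1 + s) ^ (q + 2) := fun s hs => by
    have : (0 : ℝ) < s := hs
    positivity
  have hlim : Filter.Tendsto (fun s : ℝ => -(1 / ((q : ℝ) + 1)) * (1 / (1 + s) ^ (q + 1)))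
      Filter.atTop (nhds 0) := by
    have h1 : Filter.Tendsto (fun s : ℝ => (1 + s) ^ (q + 1)) Filter.atTop Filter.atTop :=
      (Filter.tendsto_pow_atTop (by omega)).comp (Filter.tendsto_atTop_add_const_left _ _ Filter.tendsto_id)
    simpa using (h1.inv_tendsto_atTop.const_mul (-(1 / ((q : ℝ) + 1))))
  refine ⟨integrableOn_Ioi_deriv_of_nonneg' hd hpos hlim, ?_⟩
  rw [integral_Ioi_of_hasDerivAt_of_nonneg' hd hpos hlim]
  simp

theorem integrableOn_pow_div_one_add_pow (p q : ℕ) :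
    IntegrableOn (fun s : ℝ => s ^ p / (1 + s) ^ (p + q + 2)) (Set.Ioi 0) := by
  refine Integrable.mono' (integrableOn_and_integral_inv_one_add_pow q).1
    (Measurable.aestronglyMeasurable (by fun_prop)) ?_
  filter_upwards [ae_restrict_mem measurableSet_Ioi] with s hs
  have hs' : (0 : ℝ) < s := hs
  rw [Real.norm_of_nonneg (by positivity), div_le_div_iff₀ (by positivity) (by positivity), one_mul,
    add_assoc, pow_add (1 + s) p]
  exact mul_le_mul_of_nonneg_right (pow_le_pow_left₀ hs'.le (by linarith) p) (by positivity)

/-- The Beta value B(p + 1, q + 1), by induction on p: the derivative of sᵖ⁺¹/(1 + s)ᵖ⁺ᑫ⁺² has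
integral zero. -/
theorem integral_pow_div_one_add_pow (p q : ℕ) :
    ∫ s in Set.Ioi (0 : ℝ), s ^ p / (1 + s) ^ (p + q + 2)
      = p.factorial * q.factorial / (p + q + 1).factorial := by
  induction p with
  | zero =>
    have := (integrableOn_and_integral_inv_one_add_pow q).2
    simp only [pow_zero, zero_add]
    rw [this, Nat.factorial_succ]
    have : (q.factorial : ℝ) ≠ 0 := by positivity
    push_cast
    field_simp
    simp
  | succ p ih =>
    have hi1 := integrableOn_pow_div_one_add_pow p q
    have hi2 := integrableOn_pow_div_one_add_pow (p + 1) q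
    have e : p + 1 + q + 2 = p + q + 2 + 1 := by ring
    rw [e] at hi2 ⊢
    have hlim : Filter.Tendsto (fun s : ℝ => s ^ (p + 1) / (1 + s) ^ (p + q + 2))
        Filter.atTop (nhds 0) := by
      have h0 : Filter.Tendsto (fun s : ℝ => (1 + s)⁻¹) Filter.atTop (nhds 0) :=
        (Filter.tendsto_atTop_add_const_left _ _ Filter.tendsto_id).inv_tendsto_atTop
      refine squeeze_zero' ?_ ?_ h0
      · filter_upwards [Filter.eventually_gt_atTop 0] with s hs
        positivity
      · filter_upwards [Filter.eventually_gt_atTop 0] with s hs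
        have h1 : s ^ (p + 1) ≤ (1 + s) ^ (p + q + 1) :=
          (pow_le_pow_left₀ hs.le (by linarith) _).trans
            (pow_le_pow_right₀ (by linarith) (by omega))
        rw [div_le_iff₀ (by positivity), pow_succ (1 + s) (p + q + 1)]
        field_simp
        exact h1
    have h := integral_Ioi_of_hasDerivAt_of_tendsto' (a := (0 : ℝ)) (m := 0)
      (f := fun s : ℝ => s ^ (p + 1) / (1 + s) ^ (p + q + 2))
      (fun s hs => hasDerivAt_pow_div_one_add_pow p (p + q + 2) (by
        have : (0 : ℝ) ≤ s := hs
        positivity))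
      ((hi1.const_mul _).sub (hi2.const_mul _)) hlim
    rw [integral_sub (hi1.const_mul _) (hi2.const_mul _), integral_const_mul, integral_const_mul,
      ih] at h
    simp only [ne_eq, Nat.add_eq_zero_iff, one_ne_zero, and_false, not_false_eq_true, zero_pow,
      zero_div, sub_zero, sub_eq_zero] at h
    have e2 : p + 1 + q + 1 = p + q + 1 + 1 := by ring
    rw [e2, Nat.factorial_succ (p + q + 1), Nat.factorial_succ p]
    have hf : ((p + q + 1).factorial : ℝ) ≠ 0 := by positivity
    have hc : ((p : ℝ) + q + 1 + 1) ≠ 0 := by positivity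
    push_cast at h ⊢
    field_simp at h ⊢
    linear_combination -h

end BetaIntegral

/-! ### Closed forms for the density and the moments -/

/-- The density of the squared norm of `(z 1 - M)⁻¹ c` in dimension `m + 1`, where `a = N |z|²`. -/
noncomputable def resolventDensity (a : ℝ) (m : ℕ) (t : ℝ) : ℝ :=
  Real.exp (-(a * t / (1 + t))) * (t ^ m / m.factorial / (1 + t) ^ (m + 2))
    * (scaledGamma a (m + 1) * (m + 1 - a * t / (1 + t)) + a ^ (m + 1))

/-- The integral of `s ↦ exp (-a / (1 + s)) (1 + s)⁻ᵏ` against the law of the squared norm of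
`(z 1 - M)⁻¹ c` in dimension `m`, where `a = N |z|²`. -/
noncomputable def resolventMoment (a : ℝ) (m k : ℕ) : ℝ :=
  Real.exp (-a) * (k.factorial / (m + k + 1).factorial)
    * (scaledGamma a (m + 1) * (m + k + 1) - a * m * scaledGamma a m)

section Density

/-- Write G n for `scaledGamma a n`. As t/(1 + t) ≤ 1, the bracket is at least G(m+1)(m + 1 - a) +
aᵐ⁺¹ = G(m+2) - a G(m+1), which is nonnegative. -/
theorem resolventDensity_nonneg {a : ℝ} (ha : 0 ≤ a) (m : ℕ) {t : ℝ} (ht : 0 < t) : 0 ≤ resolventDensity a m t := by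
  refine mul_nonneg (by positivity) ?_
  have h1 := mul_scaledGamma_le ha (m + 1) (by omega)
  have h2 := scaledGamma_succ ha (m + 1)
  have h3 := scaledGamma_nonneg ha (m + 1)
  have h4 : a * t / (1 + t) ≤ a := by
    rw [div_le_iff₀ (by positivity)]
    nlinarith
  have h5 := mul_le_mul_of_nonneg_left h4 h3
  push_cast at h2
  nlinarith

theorem resolventMoment_nonneg {a : ℝ} (ha : 0 ≤ a) (m k : ℕ) : 0 ≤ resolventMoment a m k := by
  refine mul_nonneg (by positivity) ?_
  rcases Nat.eq_zero_or_pos m with rfl | hm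
  · have := scaledGamma_nonneg ha 1
    simp
    positivity
  · have h1 := mul_scaledGamma_le ha m hm.ne'
    have h3 := scaledGamma_nonneg ha (m + 1)
    have h4 := mul_le_mul_of_nonneg_left h1 (Nat.cast_nonneg (α := ℝ) m)
    have h5 : 0 ≤ scaledGamma a (m + 1) * (k + 1) := by positivity
    nlinarith

/-- The factorials in the moment cancel those of the transition density, leaving rᵏ/k! times an
affine function of k, with r = a/(1 + t). Only the sums of rᵏ/k! and of k rᵏ/k! are needed. -/
theorem hasSum_resolventDensity {a : ℝ} (ha : 0 ≤ a) (m : ℕ) {t : ℝ} (ht : 0 < t) :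
    HasSum (fun k : ℕ => resolventMoment a m k * (a ^ k / k.factorial * (t ^ m / m.factorial
          * ((k + m + 1).factorial / k.factorial / (1 + t) ^ (k + m + 2)))))
      (resolventDensity a m t) := by
  set r : ℝ := a / (1 + t) with hr
  have h1 : HasSum (fun k : ℕ => r ^ k / k.factorial) (Real.exp r) := by
    rw [Real.exp_eq_exp_ℝ]
    exact NormedSpace.expSeries_div_hasSum_exp r
  have h2 : HasSum (fun k : ℕ => (k : ℝ) * (r ^ k / k.factorial)) (r * Real.exp r) := by
    rw [← hasSum_nat_add_iff' 1]
    simp only [Finset.range_one, Finset.sum_singleton, Nat.cast_zero, zero_mul, sub_zero]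
    refine (h1.mul_left r).congr_fun fun k => ?_
    rw [Nat.factorial_succ]
    push_cast
    field_simp
    ring
  have h3 := (((h1.mul_left (scaledGamma a (m + 1) * (m + 1) - a * m * scaledGamma a m)).add
    (h2.mul_left (scaledGamma a (m + 1)))).mul_left
      (Real.exp (-a) * (t ^ m / m.factorial / (1 + t) ^ (m + 2))))
  have ht1 : (1 + t) ≠ 0 := by positivity
  have hval : resolventDensity a m t = Real.exp (-a) * (t ^ m / m.factorial / (1 + t) ^ (m + 2))
      * ((scaledGamma a (m + 1) * (m + 1) - a * m * scaledGamma a m) * Real.exp r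
        + scaledGamma a (m + 1) * (r * Real.exp r)) := by
    have e1 : Real.exp (-(a * t / (1 + t))) = Real.exp (-a) * Real.exp r := by
      rw [← Real.exp_add, hr]
      congr 1
      field_simp
      ring
    have e2 : a * t / (1 + t) = a - r := by rw [hr]; field_simp; ring
    -- The recurrence trades the index-m term of the moments for the aᵐ⁺¹ term of the density.
    have e3 := scaledGamma_succ ha m
    rw [resolventDensity, e1, e2]
    linear_combination (-(Real.exp (-a) * Real.exp r * (t ^ m / m.factorial / (1 + t) ^ (m + 2)) * a))
      * e3
  rw [hval]
  refine h3.congr_fun fun k => ?_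
  have e : m + k + 1 = k + m + 1 := by ring
  rw [resolventMoment, hr, e, div_pow]
  have hf : ((k + m + 1).factorial : ℝ) ≠ 0 := by positivity
  field_simp
  ring

/-- The exponentials exp(-as/(1+s)) and exp(-a/(1+s)) multiply to the constant e⁻ᵃ, so only a
difference of two Beta integrals remains. The recurrence for `scaledGamma` has put the bracket in
the form G(m+2) - a G(m+1) s/(1+s), with G n = `scaledGamma a n`. -/
theorem lintegral_resolventDensity {a : ℝ} (ha : 0 ≤ a) (m k : ℕ) :
    ∫⁻ s in Set.Ioi 0, ENNReal.ofReal (resolventDensity a m s)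
        * ENNReal.ofReal (Real.exp (-(a / (1 + s))) * (1 / (1 + s)) ^ k)
      = ENNReal.ofReal (resolventMoment a (m + 1) k) := by
  have e : ∀ s ∈ Set.Ioi (0 : ℝ), resolventDensity a m s
      * (Real.exp (-(a / (1 + s))) * (1 / (1 + s)) ^ k) = Real.exp (-a) / m.factorial
        * (scaledGamma a (m + 2) * (s ^ m / (1 + s) ^ (m + k + 2))
          - a * scaledGamma a (m + 1) * (s ^ (m + 1) / (1 + s) ^ (m + 1 + k + 2))) := by
    intro s hs
    have hs' : (0 : ℝ) < s := hs
    have e1 : Real.exp (-a) = Real.exp (-(a * s / (1 + s))) * Real.exp (-(a / (1 + s))) := by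
      rw [← Real.exp_add]
      congr 1
      field_simp
      ring
    rw [resolventDensity, e1, scaledGamma_succ ha (m + 1), one_div_pow]
    push_cast
    field_simp
    ring
  have hi1 := integrableOn_pow_div_one_add_pow m k
  have hi2 := integrableOn_pow_div_one_add_pow (m + 1) k
  have e' : ∀ s ∈ Set.Ioi (0 : ℝ), ENNReal.ofReal (resolventDensity a m s)
      * ENNReal.ofReal (Real.exp (-(a / (1 + s))) * (1 / (1 + s)) ^ k)
      = ENNReal.ofReal (Real.exp (-a) / m.factorial
        * (scaledGamma a (m + 2) * (s ^ m / (1 + s) ^ (m + k + 2))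
          - a * scaledGamma a (m + 1) * (s ^ (m + 1) / (1 + s) ^ (m + 1 + k + 2)))) := by
    intro s hs
    rw [← ENNReal.ofReal_mul (resolventDensity_nonneg ha m hs), e s hs]
  rw [setLIntegral_congr_fun measurableSet_Ioi e', ← ofReal_integral_eq_lintegral_ofReal]
  · congr 1
    rw [integral_const_mul, integral_sub (hi1.const_mul _) (hi2.const_mul _), integral_const_mul,
      integral_const_mul, integral_pow_div_one_add_pow, integral_pow_div_one_add_pow,
      resolventMoment]
    have e2 : m + 1 + k + 1 = m + k + 1 + 1 := by ring
    rw [e2, Nat.factorial_succ (m + k + 1), Nat.factorial_succ m]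
    have hf : ((m + k + 1).factorial : ℝ) ≠ 0 := by positivity
    have hc : ((m : ℝ) + k + 1 + 1) ≠ 0 := by positivity
    push_cast
    field_simp
    ring
  · exact ((hi1.const_mul _).sub (hi2.const_mul _)).const_mul _
  · filter_upwards [ae_restrict_mem measurableSet_Ioi] with s hs
    have hs' : (0 : ℝ) < s := hs
    rw [← e s hs]
    exact mul_nonneg (resolventDensity_nonneg ha m hs') (by positivity)

end Density

theorem measurable_resolventDensity (a : ℝ) (m : ℕ) : Measurable (resolventDensity a m) := by
  unfold resolventDensity
  fun_prop

theorem resolventNormSqLaw_succ_eq_of_moment {N : ℕ} (hN : N ≠ 0) (z : ℂ) (m : ℕ)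
    (h : ∀ k : ℕ, ∫⁻ s, ENNReal.ofReal (Real.exp (-(N * ‖z‖ ^ 2 / (1 + s))) * (1 / (1 + s)) ^ k)
      ∂(resolventNormSqLaw N z m) = ENNReal.ofReal (resolventMoment (N * ‖z‖ ^ 2) m k)) :
    resolventNormSqLaw N z (m + 1) = (volume.restrict (Set.Ioi 0)).withDensity
      fun t => ENNReal.ofReal (resolventDensity (N * ‖z‖ ^ 2) m t) := by
  have ha : 0 ≤ (N : ℝ) * ‖z‖ ^ 2 := by positivity
  refine Measure.ext_of_lintegral _ fun f hf => ?_
  rw [lintegral_resolventNormSqLaw_succ_eq_tsum hN z m hf, lintegral_withDensity_eq_lintegral_mul _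
    (measurable_resolventDensity _ _).ennreal_ofReal hf]
  refine setLIntegral_congr_fun measurableSet_Ioi fun t ht => ?_
  have ht' : (0 : ℝ) < t := ht
  have hs := hasSum_resolventDensity ha m ht'
  rw [Pi.mul_apply, mul_comm, ← hs.tsum_eq, ENNReal.ofReal_tsum_of_nonneg _ hs.summable]
  · congr 1
    refine tsum_congr fun k => ?_
    rw [h k, ENNReal.ofReal_mul (resolventMoment_nonneg ha m k)]
  · exact fun k => mul_nonneg (resolventMoment_nonneg ha m k) (by positivity)

/-- Induction on the dimension, for all k at once: the density in dimension m + 1 needs every moment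
in dimension m. -/
theorem lintegral_resolventNormSqLaw_moment {N : ℕ} (hN : N ≠ 0) (z : ℂ) (m k : ℕ) :
    ∫⁻ s, ENNReal.ofReal (Real.exp (-(N * ‖z‖ ^ 2 / (1 + s))) * (1 / (1 + s)) ^ k)
      ∂(resolventNormSqLaw N z m) = ENNReal.ofReal (resolventMoment (N * ‖z‖ ^ 2) m k) := by
  have ha : 0 ≤ (N : ℝ) * ‖z‖ ^ 2 := by positivity
  induction m generalizing k with
  | zero =>
    -- In dimension 0 the squared norm is an empty sum, so s = 0 and every moment is e⁻ᵃ. The closed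
    -- form agrees because `scaledGamma a 1` is 1.
    rw [resolventNormSqLaw, lintegral_map (by fun_prop) (measurable_resolventNormSq_prod z 0)]
    simp only [resolventNormSq, Finset.univ_eq_empty, Finset.sum_empty, add_zero, div_one, one_pow,
      mul_one, lintegral_const, measure_univ]
    congr 1
    have h1 := scaledGamma_succ ha 0
    have hk : (k.factorial : ℝ) ≠ 0 := by positivity
    simp only [Nat.cast_zero, zero_mul, pow_zero, zero_add] at h1
    simp only [resolventMoment, zero_add, h1, Nat.factorial_succ]
    push_cast
    field_simp
    simp
  | succ m ih =>
    rw [resolventNormSqLaw_succ_eq_of_moment hN z m ih, lintegral_withDensity_eq_lintegral_mul _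
      (measurable_resolventDensity _ _).ennreal_ofReal (by fun_prop)]
    exact lintegral_resolventDensity ha m k

/-! ### Identification of the mixing law and conclusion -/

theorem mixingDensity_eq_resolventDensity (m : ℕ) (z : ℂ) {t : ℝ} (ht : 0 < t) :
    mixingDensity (m + 2) z t = resolventDensity (((m + 2 : ℕ) : ℝ) * ‖z‖ ^ 2) m t := by
  have e1 : ((m + 2 : ℕ) : ℝ) - 1 = ((m + 1 : ℕ) : ℝ) := by push_cast; ring
  have e2 : ∀ x : ℝ, x / (1 + 1 / t) = x * t / (1 + t) := fun x => by field_simp; ring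
  rw [mixingDensity, resolventDensity, e1, e2, scaledGamma]
  have e3 : m + 2 - 2 = m := by omega
  have e4 : m + 2 - 1 = m + 1 := by omega
  rw [e3, e4]
  push_cast
  field_simp

theorem resolventNormSqLaw_eq_mixingLaw (m : ℕ) (z : ℂ) :
    resolventNormSqLaw (m + 2) z (m + 1) = mixingLaw (m + 2) z := by
  rw [resolventNormSqLaw_succ_eq_of_moment (by omega) z m
    (lintegral_resolventNormSqLaw_moment (by omega) z m), mixingLaw]
  refine withDensity_congr_ae ?_
  filter_upwards [ae_restrict_mem measurableSet_Ioi] with t ht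
  rw [mixingDensity_eq_resolventDensity m z ht]

theorem IsComplexGinibre.hasLaw_gaussianPi {Ω : Type*} [MeasurableSpace Ω] {P : Measure Ω}
    [IsProbabilityMeasure P] {N : ℕ} {M : Ω → Matrix (Fin N) (Fin N) ℂ}
    (hM : IsComplexGinibre M P) :
    HasLaw (fun ω (p : Fin N × Fin N) => M ω p.1 p.2)
      (gaussianPi (Fin N × Fin N) (1 / (N : ℝ≥0))) P where
  aemeasurable := aemeasurable_pi_lambda _ fun p => (hM.hasLaw p.1 p.2).aemeasurable
  map_eq := by
    refine ((iIndepFun_iff_map_fun_eq_pi_map fun p : Fin N × Fin N =>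
      (hM.hasLaw p.1 p.2).aemeasurable).1 hM.iIndepFun).trans ?_
    rw [gaussianPi]
    congr 1
    funext p
    exact (hM.hasLaw p.1 p.2).map_eq

/-- For an `N × N` complex Ginibre matrix `M` and `z : ℂ`, almost surely `z` is outside the spectrum
of `M` and the resolvent entry does not vanish, and there is a random variable `t` with density
`mixingDensity N z` on `(0, ∞)` such that, conditionally on `t`, the variable
`1 / [(z 1 - M)⁻¹]₁₁ - z` has law `N_ℂ(0, (1 + t) / N)` (expressed through the joint law); in
particular its law is the corresponding Gaussian mixture. -/
theorem theorem1 {Ω : Type*} [MeasurableSpace Ω] (P : Measure Ω) [IsProbabilityMeasure P]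
    (N : ℕ) [NeZero N] (hN : 2 ≤ N)
    (M : Ω → Matrix (Fin N) (Fin N) ℂ) (hM : IsComplexGinibre M P) (z : ℂ) :
    (∀ᵐ ω ∂P, z ∉ spectrum ℂ (M ω) ∧ resolvent11 (M ω) z ≠ 0) ∧
    (∀ t : ℝ, 0 < t → 0 ≤ mixingDensity N z t) ∧
    ∃ t : Ω → ℝ, HasLaw t (mixingLaw N z) P ∧
      HasLaw (fun ω => (t ω, 1 / resolvent11 (M ω) z - z))
        (mixingLaw N z ⊗ₘ varianceKernel N) P ∧
      HasLaw (fun ω => 1 / resolvent11 (M ω) z - z)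
        ((mixingLaw N z).bind (varianceKernel N)) P := by
  obtain ⟨m, rfl⟩ : ∃ m, N = m + 2 := ⟨N - 2, by omega⟩
  have hlaw := hM.hasLaw_gaussianPi
  have hpair := measurable_schurPair z
    (M := fun x : Fin (m + 2) × Fin (m + 2) → ℂ => Matrix.of (Function.curry x))
    (fun i j => by simp only [Matrix.of_apply, Function.curry]; fun_prop)
  have hae : ∀ᵐ ω ∂P, IsUnit (z • (1 : Matrix (Fin (m + 1)) (Fin (m + 1)) ℂ)
      - (M ω).submatrix Fin.succ Fin.succ) ∧ schurDenominator z (M ω) ≠ 0 := by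
    have h := ae_isUnit_and_schurDenominator_ne_zero (N := m + 2) (by omega) z (m + 1)
    rw [← hlaw.map_eq] at h
    exact ae_of_ae_map hlaw.aemeasurable h
  have hres : ∀ᵐ ω ∂P, 1 / resolvent11 (M ω) z - z = (schurPair z (M ω)).2 := by
    filter_upwards [hae] with ω hω
    rw [resolvent11_eq_inv_schurDenominator hω.1 hω.2, one_div, inv_inv, schurPair]
  have hprob : IsProbabilityMeasure (mixingLaw (m + 2) z) := by
    rw [← resolventNormSqLaw_eq_mixingLaw]
    infer_instance
  have hschur : HasLaw (fun ω => schurPair z (M ω))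
      (mixingLaw (m + 2) z ⊗ₘ varianceKernel (m + 2)) P := by
    have h : HasLaw (fun x => schurPair z (Matrix.of (Function.curry x)))
        (mixingLaw (m + 2) z ⊗ₘ varianceKernel (m + 2))
        (gaussianPi (Fin (m + 2) × Fin (m + 2)) (1 / ((m + 2 : ℕ) : ℝ≥0))) :=
      ⟨hpair.aemeasurable, by
        rw [map_schurPair_gaussianPi (m + 2) z (m + 1), resolventNormSqLaw_eq_mixingLaw]⟩
    have hc := h.comp hlaw
    have e : (fun x : Fin (m + 2) × Fin (m + 2) → ℂ => schurPair z (Matrix.of (Function.curry x)))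
        ∘ (fun ω (p : Fin (m + 2) × Fin (m + 2)) => M ω p.1 p.2) = fun ω => schurPair z (M ω) :=
      funext fun ω => congrArg (schurPair z)
        (Matrix.ext fun i j => rfl : Matrix.of (Function.curry fun p => M ω p.1 p.2) = M ω)
    rwa [e] at hc
  have hjoint : HasLaw (fun ω => ((schurPair z (M ω)).1, 1 / resolvent11 (M ω) z - z))
      (mixingLaw (m + 2) z ⊗ₘ varianceKernel (m + 2)) P :=
    hschur.congr (hres.mono fun ω hω => Prod.ext rfl hω)
  -- The mixing variable is ‖(z - M')⁻¹c‖², a function of `M` itself, so it lives on the given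
  -- probability space with no extra randomness.
  refine ⟨?_, fun t ht => ?_, fun ω => (schurPair z (M ω)).1, ?_, hjoint, ?_⟩
  · filter_upwards [hae] with ω hω
    constructor
    · rw [spectrum.mem_iff, not_not, Algebra.algebraMap_eq_smul_one]
      exact (isUnit_of_schurDenominator_ne_zero hω.1 hω.2).1
    · rw [resolvent11_eq_inv_schurDenominator hω.1 hω.2]
      exact inv_ne_zero hω.2
  · rw [mixingDensity_eq_resolventDensity m z ht]
    exact resolventDensity_nonneg (by positivity) m ht
  · refine ⟨measurable_fst.comp_aemeasurable hschur.aemeasurable, ?_⟩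
    have := congrArg Measure.fst hschur.map_eq
    rw [Measure.fst_compProd, Measure.fst, AEMeasurable.map_map_of_aemeasurable
      measurable_fst.aemeasurable hschur.aemeasurable] at this
    exact this
  · refine ⟨measurable_snd.comp_aemeasurable hjoint.aemeasurable, ?_⟩
    have := congrArg Measure.snd hjoint.map_eq
    rw [Measure.snd_compProd, Measure.snd, AEMeasurable.map_map_of_aemeasurable
      measurable_snd.aemeasurable hjoint.aemeasurable] at this
    exact this
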